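/- Let $X$ be a smooth projective toric variety over an algebraically closed field $k$, with Cox ring $S$ (a polynomial ring graded by $\operatorname{Pic}(X)$) and irrelevant ideal $B$. Let $M$ be a finitely generated $\operatorname{Pic}(X)$-graded $S$-module with associated sheaf $\widetilde M$ on $X$. A virtual resolution of $M$ is a complex $F_0\leftarrow F_1\leftarrow\cdots$ of finitely generated free $\operatorname{Pic}(X)$-graded $S$-modules whose associated complex of sheaves is a locally free resolution of $\widetilde M$; $\operatorname{vdim} M$ is the minimal length of a virtual resolution of $M$; $\operatorname{codim} M$ is the codimension of $\operatorname{Spec}(S/\operatorname{Ann} M)$ in $\operatorname{Spec} S$; and $M$ is virtually Cohen--Macaulay if $\widetilde M\neq 0$ and $\operatorname{vdim} M=\operatorname{codim} M$. A module is $B$-saturated if it has no nonzero element killed by a power of $B$. An ideal is relevant if it contains no power $B^t$, $t\ge 1$, and an ideal $I$ is unmixed if $\dim S/P=\dim S/I$ for every associated prime $P$ of $S/I$. Suppose that $M$ is virtually Cohen--Macaulay. Then: (a) If $M$ is $B$-saturated, then $\dim S/P=\dim M$ for every associated prime $P$ of $M$. (b) $M$ is virtually unmixed, that is: (1) $\dim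 S/P=\dim M$ for every relevant associated prime $P$ of $M$; (2) for every $B$-saturated $\operatorname{Pic}(X)$-graded $S$-module $N$ with $\widetilde N\cong\widetilde M$, $\dim S/P=\dim N$ for every associated prime $P$ of $N$; (3) the $B$-saturation $(\operatorname{Ann}_S M:B^\infty)$ is an unmixed ideal; (4) for every $N$ as in (2), $\operatorname{Ann}_S N$ is an unmixed ideal. -/

import Mathlib

universe v

/-- The convex cone in `ℝⁿ` generated by the lattice vectors `gen ρ`, `ρ ∈ σ`. -/
noncomputable def latticeCone {n : ℕ} {ι : Type*} (gen : ι → Fin n → ℤ) (σ : Finset ι) :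
    PointedCone ℝ (Fin n → ℝ) :=
  PointedCone.hull ℝ ((fun ρ i => (gen ρ i : ℝ)) '' (σ : Set ι))

/-- A smooth projective toric variety, given by its fan in the lattice `N = ℤⁿ`.  The rays of the
fan are indexed by `ι`, `gen ρ` is the primitive generator of the ray `ρ`, and a cone of the fan is
recorded by the finite set of its rays (every smooth cone is simplicial). -/
structure SmoothProjectiveFan (n : ℕ) (ι : Type*) [Fintype ι] [DecidableEq ι] where
  /-- The primitive generators of the rays. -/
  gen : ι → Fin n → ℤ
  /-- The cones of the fan, as sets of rays. -/
  cones : Finset (Finset ι)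
  empty_mem : ∅ ∈ cones
  ray_mem : ∀ ρ, {ρ} ∈ cones
  face_mem : ∀ σ ∈ cones, ∀ τ ⊆ σ, τ ∈ cones
  /-- Two cones of the fan intersect in a common face. -/
  inter_eq : ∀ σ ∈ cones, ∀ τ ∈ cones,
    latticeCone gen σ ⊓ latticeCone gen τ = latticeCone gen (σ ∩ τ)
  /-- Smoothness: the ray generators of each cone are part of a `ℤ`-basis of the lattice. -/
  smooth : ∀ σ ∈ cones, ∃ (b : Module.Basis (Fin n) ℤ (Fin n → ℤ)) (e : ι → Fin n),
    Set.InjOn e σ ∧ ∀ ρ ∈ σ, b (e ρ) = gen ρ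
  /-- Completeness: the cones cover `ℝⁿ`. -/
  complete : ∀ v : Fin n → ℝ, ∃ σ ∈ cones, v ∈ latticeCone gen σ
  /-- Projectivity: there is an ample torus-invariant divisor `∑ a ρ • D_ρ`, that is, one whose
  support function is strictly convex. -/
  projective : ∃ a : ι → ℤ, ∀ σ, Maximal (· ∈ cones) σ → ∃ m : Fin n → ℤ,
    (∀ ρ ∈ σ, m ⬝ᵥ gen ρ = -a ρ) ∧ ∀ ρ ∉ σ, -a ρ < m ⬝ᵥ gen ρ

namespace SmoothProjectiveFan

variable {n : ℕ} {ι : Type*} [Fintype ι] [DecidableEq ι]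

/-- The map sending a character `m` to its divisor `∑ ⟨m, u_ρ⟩ D_ρ`. -/
def divMap (X : SmoothProjectiveFan n ι) : (Fin n → ℤ) →ₗ[ℤ] (ι → ℤ) :=
  (Matrix.of X.gen).mulVecLin

/-- `Pic X`: torus-invariant divisors modulo divisors of characters (this is the class group, which
is the Picard group because `X` is smooth). -/
abbrev Pic (X : SmoothProjectiveFan n ι) : Type _ := (ι → ℤ) ⧸ LinearMap.range X.divMap

noncomputable instance (X : SmoothProjectiveFan n ι) : DecidableEq X.Pic := Classical.decEq _

/-- The degree of the variable `x_ρ`: the class of the divisor `D_ρ`. -/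
def varDeg (X : SmoothProjectiveFan n ι) (ρ : ι) : X.Pic :=
  Submodule.Quotient.mk (Pi.single ρ 1)

/-- The Cox ring of `X` over `k`. -/
abbrev Cox (_X : SmoothProjectiveFan n ι) (k : Type*) [Field k] : Type _ := MvPolynomial ι k

variable (X : SmoothProjectiveFan n ι) (k : Type*) [Field k]

/-- The `Pic X`-grading of the Cox ring. -/
noncomputable def grading : X.Pic → Submodule k (X.Cox k) :=
  MvPolynomial.weightedHomogeneousSubmodule k X.varDeg

/-- The monomial `∏_{ρ ∉ σ} x_ρ`. -/
noncomputable def hat (σ : Finset ι) : X.Cox k := ∏ ρ ∈ σᶜ, MvPolynomial.X ρ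

/-- The degree of the monomial `X.hat k σ`. -/
def hatDeg (σ : Finset ι) : X.Pic := ∑ ρ ∈ σᶜ, X.varDeg ρ

/-- The irrelevant ideal of the Cox ring. -/
noncomputable def irrelevant : Ideal (X.Cox k) := Ideal.span (X.hat k '' (X.cones : Set (Finset ι)))

instance : SetLike.GradedMonoid (X.grading k) :=
  MvPolynomial.WeightedHomogeneousSubmodule.gradedMonoid

noncomputable instance : GradedAlgebra (X.grading k) :=
  MvPolynomial.weightedGradedAlgebra k X.varDeg

/-- The multiplicative set of powers of `X.hat k σ`. -/
noncomputable abbrev hatPowers (σ : Finset ι) : Submonoid (X.Cox k) := Submonoid.powers (X.hat k σ)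

/-- The element `(X.hat k σ) ^ t` of the multiplicative set. -/
noncomputable def hatPow (σ : Finset ι) (t : ℕ) : X.hatPowers k σ := ⟨X.hat k σ ^ t, t, rfl⟩

variable {k}

theorem hat_mem (σ : Finset ι) : X.hat k σ ∈ X.grading k (X.hatDeg σ) :=
  SetLike.prod_mem_graded (A := X.grading k) X.varDeg _
    fun ρ _ => MvPolynomial.isWeightedHomogeneous_X k X.varDeg ρ

theorem hat_pow_mem (σ : Finset ι) (t : ℕ) : X.hat k σ ^ t ∈ X.grading k (t • X.hatDeg σ) :=
  SetLike.pow_mem_graded t (X.hat_mem σ)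

theorem hatPow_mul (σ : Finset ι) (s t : ℕ) :
    X.hatPow k σ s * X.hatPow k σ t = X.hatPow k σ (s + t) :=
  Subtype.ext (pow_add _ _ _).symm

theorem hatPow_zero (σ : Finset ι) : X.hatPow k σ 0 = 1 := Subtype.ext (pow_zero _)

theorem hat_face {σ τ : Finset ι} (h : τ ⊆ σ) :
    X.hat k τ = X.hat k (τ ∪ σᶜ) * X.hat k σ := by
  unfold hat
  rw [← Finset.prod_union]
  · congr 1; ext ρ; have := @h ρ; simp; tauto
  · rw [Finset.disjoint_left]; intro ρ; simp

theorem hatDeg_face {σ τ : Finset ι} (h : τ ⊆ σ) :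
    X.hatDeg τ = X.hatDeg (τ ∪ σᶜ) + X.hatDeg σ := by
  unfold hatDeg
  rw [← Finset.sum_union]
  · congr 1; ext ρ; have := @h ρ; simp; tauto
  · rw [Finset.disjoint_left]; intro ρ; simp

variable (k)

/-- The coordinate ring of the affine chart `U_σ` of `X`: the degree zero part of the localization
of the Cox ring at `X.hat k σ`. -/
noncomputable def chartRing (σ : Finset ι) : Subalgebra k (Localization (X.hatPowers k σ)) where
  carrier := {z | ∃ (t : ℕ), ∃ s ∈ X.grading k (t • X.hatDeg σ),
    z = Localization.mk s (X.hatPow k σ t)}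
  mul_mem' := by
    rintro _ _ ⟨t, s, hs, rfl⟩ ⟨t', s', hs', rfl⟩
    refine ⟨t + t', s * s', ?_, ?_⟩
    · rw [add_smul]; exact SetLike.mul_mem_graded hs hs'
    · rw [Localization.mk_mul, hatPow_mul]
  add_mem' := by
    rintro _ _ ⟨t, s, hs, rfl⟩ ⟨t', s', hs', rfl⟩
    refine ⟨t + t', X.hat k σ ^ t * s' + X.hat k σ ^ t' * s, add_mem ?_ ?_, ?_⟩
    · rw [add_smul]; exact SetLike.mul_mem_graded (X.hat_pow_mem σ t) hs'
    · rw [add_comm t, add_smul]; exact SetLike.mul_mem_graded (X.hat_pow_mem σ t') hs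
    · rw [Localization.add_mk, hatPow_mul]; rfl
  algebraMap_mem' c := by
    refine ⟨0, algebraMap k _ c, ?_, ?_⟩
    · rw [zero_smul]; exact SetLike.algebraMap_mem_graded (X.grading k) c
    · rw [hatPow_zero, IsScalarTower.algebraMap_apply k (X.Cox k), Localization.mk_one_eq_algebraMap]

section GradedModules

variable {M : Type*} [AddCommGroup M] [Module (X.Cox k) M]
variable (ℳ : X.Pic → AddSubgroup M) [SetLike.GradedSMul (X.grading k) ℳ]
variable {N : Type*} [AddCommGroup N] [Module (X.Cox k) N]
variable (𝒩 : X.Pic → AddSubgroup N) [SetLike.GradedSMul (X.grading k) 𝒩]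

/-- The sections over the affine chart `U_σ` of the sheaf `M~` associated to a graded module `M`:
the degree zero part of the localization of `M` at `X.hat k σ`. -/
noncomputable def sections (σ : Finset ι) :
    Submodule (X.chartRing k σ) (LocalizedModule (X.hatPowers k σ) M) where
  carrier := {z | ∃ (t : ℕ), ∃ m ∈ ℳ (t • X.hatDeg σ), z = LocalizedModule.mk m (X.hatPow k σ t)}
  zero_mem' := ⟨0, 0, zero_mem _, (LocalizedModule.zero_mk _).symm⟩
  add_mem' := by
    rintro _ _ ⟨t, s, hs, rfl⟩ ⟨t', s', hs', rfl⟩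
    refine ⟨t + t', X.hat k σ ^ t' • s + X.hat k σ ^ t • s', add_mem ?_ ?_, ?_⟩
    · rw [add_comm t, add_smul]; exact SetLike.GradedSMul.smul_mem (X.hat_pow_mem σ t') hs
    · rw [add_smul]; exact SetLike.GradedSMul.smul_mem (X.hat_pow_mem σ t) hs'
    · rw [LocalizedModule.mk_add_mk, hatPow_mul]; rfl
  smul_mem' := by
    rintro ⟨_, t, s, hs, rfl⟩ _ ⟨t', m, hm, rfl⟩
    refine ⟨t + t', s • m, ?_, ?_⟩
    · rw [add_smul]; exact SetLike.GradedSMul.smul_mem hs hm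
    · rw [← hatPow_mul]; exact LocalizedModule.mk_smul_mk _ _ _ _

noncomputable instance (σ : Finset ι) : Module (X.chartRing k σ) (X.sections k ℳ σ) :=
  (X.sections k ℳ σ).module

variable {k} in
theorem isUnit_hatPowers {σ τ : Finset ι} (h : τ ⊆ σ) (x : X.hatPowers k σ) :
    IsUnit (algebraMap (X.Cox k)
      (Module.End (X.Cox k) (LocalizedModule (X.hatPowers k τ) M)) x) := by
  obtain ⟨_, t, rfl⟩ := x
  have hu := IsLocalizedModule.map_units
    (LocalizedModule.mkLinearMap (X.hatPowers k τ) M) (X.hatPow k τ t)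
  have he : ((X.hatPow k τ t : X.hatPowers k τ) : X.Cox k)
      = X.hat k (τ ∪ σᶜ) ^ t * X.hat k σ ^ t := by
    simp only [hatPow]; rw [X.hat_face h, mul_pow]
  rw [he, map_mul] at hu
  exact ((((Commute.all _ _).map (algebraMap (X.Cox k) _)).isUnit_mul_iff).mp hu).2

variable {k} in
/-- The localization map `M[1 / X.hat k σ] → M[1 / X.hat k τ]` for a face `τ` of `σ`. -/
noncomputable def locMap (M : Type*) [AddCommGroup M] [Module (X.Cox k) M]
    {σ τ : Finset ι} (h : τ ⊆ σ) :
    LocalizedModule (X.hatPowers k σ) M →ₗ[X.Cox k] LocalizedModule (X.hatPowers k τ) M :=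
  LocalizedModule.lift _ (LocalizedModule.mkLinearMap _ M) (X.isUnit_hatPowers h)

variable {k} in
theorem locMap_mk {σ τ : Finset ι} (h : τ ⊆ σ) (m : M) (t : ℕ) :
    X.locMap M h (LocalizedModule.mk m (X.hatPow k σ t)) =
      LocalizedModule.mk (X.hat k (τ ∪ σᶜ) ^ t • m) (X.hatPow k τ t) := by
  unfold locMap
  rw [LocalizedModule.lift_mk, Module.End.algebraMap_isUnit_inv_apply_eq_iff,
    LocalizedModule.mkLinearMap_apply, LocalizedModule.smul'_mk, smul_smul]
  have he : ((X.hatPow k σ t : X.hatPowers k σ) : X.Cox k) * X.hat k (τ ∪ σᶜ) ^ t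
      = (X.hatPow k τ t : X.hatPowers k τ) := by
    simp only [hatPow]; rw [X.hat_face h, mul_pow, mul_comm]
  rw [he]
  exact (LocalizedModule.mk_cancel _ _).symm

/-- The restriction map `M~(U_σ) → M~(U_τ)` for a face `τ` of `σ`. -/
noncomputable def restrict {σ τ : Finset ι} (h : τ ⊆ σ) :
    X.sections k ℳ σ →+ X.sections k ℳ τ where
  toFun z := ⟨X.locMap M h z, by
    obtain ⟨_, t, m, hm, rfl⟩ := z
    refine ⟨t, _, ?_, X.locMap_mk h m t⟩
    rw [X.hatDeg_face h, smul_add]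
    exact SetLike.GradedSMul.smul_mem (X.hat_pow_mem _ t) hm⟩
  map_zero' := Subtype.ext (map_zero (X.locMap M h))
  map_add' a b := Subtype.ext (map_add (X.locMap M h) a.1 b.1)

/-- A morphism `M~ → N~` of quasi-coherent sheaves on `X`: linear maps on the affine charts `U_σ`
that are compatible with restriction to the charts of the faces
(recall that `U_σ ∩ U_σ' = U_{σ ∩ σ'}`). -/
structure SheafHom where
  app : ∀ σ ∈ X.cones, X.sections k ℳ σ →ₗ[X.chartRing k σ] X.sections k 𝒩 σ
  app_restrict : ∀ σ (hσ : σ ∈ X.cones) τ (h : τ ⊆ σ) (z : X.sections k ℳ σ),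
    app τ (X.face_mem σ hσ τ h) (X.restrict k ℳ h z) = X.restrict k 𝒩 h (app σ hσ z)

/-- `M~` and `N~` are isomorphic as sheaves on `X`. -/
def SheafIso : Prop :=
  ∃ φ : X.SheafHom k ℳ 𝒩, ∀ σ (hσ : σ ∈ X.cones), Function.Bijective (φ.app σ hσ)

/-- The sheaf `M~` is nonzero. -/
def SheafNonzero : Prop := ∃ σ ∈ X.cones, Nontrivial (X.sections k ℳ σ)

variable {k ℳ 𝒩}

/-- The map `M~(U_σ) → N~(U_σ)` induced by a homomorphism of graded modules of degree zero. -/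
noncomputable def sectionsMap (f : M →ₗ[X.Cox k] N) (hf : ∀ d, ∀ m ∈ ℳ d, f m ∈ 𝒩 d)
    (σ : Finset ι) : X.sections k ℳ σ →ₗ[X.chartRing k σ] X.sections k 𝒩 σ where
  toFun z := ⟨LocalizedModule.map (X.hatPowers k σ) f z, by
    obtain ⟨_, t, m, hm, rfl⟩ := z
    exact ⟨t, f m, hf _ m hm, LocalizedModule.map_mk (X.hatPowers k σ) f m _⟩⟩
  map_add' a b := Subtype.ext (map_add _ _ _)
  map_smul' r a := Subtype.ext (map_smul (LocalizedModule.map (X.hatPowers k σ) f) r.1 a.1)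

end GradedModules

/-- The grading of the free module `⊕ⱼ S(-aⱼ)`. -/
noncomputable def freeGrading {r : ℕ} (a : Fin r → X.Pic) (d : X.Pic) : AddSubgroup (Fin r → X.Cox k) where
  carrier := {f | ∀ j, f j ∈ X.grading k (d - a j)}
  zero_mem' _ := zero_mem _
  add_mem' hf hg j := add_mem (hf j) (hg j)
  neg_mem' hf j := neg_mem (hf j)

instance {r : ℕ} (a : Fin r → X.Pic) :
    SetLike.GradedSMul (X.grading k) (X.freeGrading k a) where
  smul_mem {i j s f} hs hf l := by
    have h : (i +ᵥ j : X.Pic) - a l = i + (j - a l) := by rw [vadd_eq_add]; abel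
    rw [h]
    exact SetLike.mul_mem_graded hs (hf l)

/-- A complex `F₀ ← F₁ ← ⋯` of finitely generated free graded modules over the Cox ring, with
differentials of degree zero; `Fᵢ = ⊕ⱼ S(-twist i j)`. -/
structure FreeComplex where
  rank : ℕ → ℕ
  twist : ∀ i, Fin (rank i) → X.Pic
  d : ∀ i, (Fin (rank (i + 1)) → X.Cox k) →ₗ[X.Cox k] (Fin (rank i) → X.Cox k)
  d_mem : ∀ i e, ∀ f ∈ X.freeGrading k (twist (i + 1)) e, d i f ∈ X.freeGrading k (twist i) e
  d_comp_d : ∀ i, d i ∘ₗ d (i + 1) = 0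

/-- The length of a free complex: the supremum of the `i` with `Fᵢ ≠ 0`. -/
noncomputable def FreeComplex.length {X : SmoothProjectiveFan n ι} {k : Type*} [Field k]
    (F : X.FreeComplex k) : ℕ∞ :=
  ⨆ (i : ℕ) (_ : F.rank i ≠ 0), (i : ℕ∞)

/-- The map `Fᵢ₊₁~(U_σ) → Fᵢ~(U_σ)` induced by the differential. -/
noncomputable def FreeComplex.dSections {X : SmoothProjectiveFan n ι} {k : Type*} [Field k]
    (F : X.FreeComplex k) (i : ℕ) (σ : Finset ι) :
    X.sections k (X.freeGrading k (F.twist (i + 1))) σ →ₗ[X.chartRing k σ]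
      X.sections k (X.freeGrading k (F.twist i)) σ :=
  X.sectionsMap (F.d i) (F.d_mem i) σ

section VirtuallyCM

variable {M : Type*} [AddCommGroup M] [Module (X.Cox k) M]
variable (ℳ : X.Pic → AddSubgroup M) [SetLike.GradedSMul (X.grading k) ℳ]

/-- `F` is a virtual resolution of `M`: there is a morphism of sheaves `F₀~ → M~` making
`0 ← M~ ← F₀~ ← F₁~ ← ⋯` an exact complex of sheaves (exactness is tested on the affine charts). -/
def IsVirtualResolution (F : X.FreeComplex k) : Prop :=
  ∃ ε : X.SheafHom k (X.freeGrading k (F.twist 0)) ℳ, ∀ σ (hσ : σ ∈ X.cones),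
    Function.Surjective (ε.app σ hσ) ∧
    Function.Exact (F.dSections 0 σ) (ε.app σ hσ) ∧
    ∀ i, Function.Exact (F.dSections (i + 1) σ) (F.dSections i σ)

/-- The virtual dimension of `M`: the minimal length of a virtual resolution. -/
noncomputable def vdim : ℕ∞ := ⨅ (F : X.FreeComplex k) (_ : X.IsVirtualResolution k ℳ F), F.length

/-- `M` is virtually Cohen--Macaulay: `M~ ≠ 0` and `vdim M = codim M`, where `codim M` is the
codimension of `Spec (S / Ann M)` in `Spec S`. -/
def IsVirtuallyCM : Prop :=
  X.SheafNonzero k ℳ ∧ X.vdim k ℳ = (Module.annihilator (X.Cox k) M).height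

/-- An ideal is relevant if it contains no power of the irrelevant ideal. -/
def IsRelevant (I : Ideal (X.Cox k)) : Prop := ∀ t : ℕ, 1 ≤ t → ¬ X.irrelevant k ^ t ≤ I

/-- `M` is `B`-saturated: the submodule `H⁰_B(M)` of elements killed by a power of the irrelevant
ideal `B` is zero. -/
def IsSaturated (M : Type*) [AddCommGroup M] [Module (X.Cox k) M] : Prop :=
  ∀ m : M, (∃ t : ℕ, ∀ b ∈ X.irrelevant k ^ t, b • m = 0) → m = 0

/-- The saturation `(I : B^∞)` of an ideal with respect to the irrelevant ideal `B`. -/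
noncomputable def saturation (I : Ideal (X.Cox k)) : Ideal (X.Cox k) :=
  ⨆ t : ℕ, Submodule.colon I (X.irrelevant k ^ t : Ideal (X.Cox k))

end VirtuallyCM

/-- An ideal `I` of a ring `S` is unmixed if `dim S/P = dim S/I` for all its associated primes. -/
def UnmixedIdeal {S : Type*} [CommRing S] (I : Ideal S) : Prop :=
  ∀ P ∈ associatedPrimes S (S ⧸ I), ringKrullDim (S ⧸ P) = ringKrullDim (S ⧸ I)

/-- `M` is virtually unmixed: all four conditions below hold. In the second and the fourth one, `N`
is any `B`-saturated graded module with `N~ ≅ M~` (finitely generated or not). -/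
structure IsVirtuallyUnmixed {M : Type v} [AddCommGroup M] [Module (X.Cox k) M]
    (ℳ : X.Pic → AddSubgroup M) [SetLike.GradedSMul (X.grading k) ℳ] : Prop where
  relevant : ∀ P ∈ associatedPrimes (X.Cox k) M, X.IsRelevant k P →
    ringKrullDim (X.Cox k ⧸ P) = Module.supportDim (X.Cox k) M
  saturated : ∀ (N : Type v) [AddCommGroup N] [Module (X.Cox k) N] (𝒩 : X.Pic → AddSubgroup N)
    [DirectSum.Decomposition 𝒩] [SetLike.GradedSMul (X.grading k) 𝒩],
    X.IsSaturated k N → X.SheafIso k 𝒩 ℳ → ∀ P ∈ associatedPrimes (X.Cox k) N,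
      ringKrullDim (X.Cox k ⧸ P) = Module.supportDim (X.Cox k) N
  annihilator : UnmixedIdeal (X.saturation k (Module.annihilator (X.Cox k) M))
  saturated_annihilator : ∀ (N : Type v) [AddCommGroup N] [Module (X.Cox k) N]
    (𝒩 : X.Pic → AddSubgroup N) [DirectSum.Decomposition 𝒩]
    [SetLike.GradedSMul (X.grading k) 𝒩],
    X.IsSaturated k N → X.SheafIso k 𝒩 ℳ → UnmixedIdeal (Module.annihilator (X.Cox k) N)

end SmoothProjectiveFan

/-! Everything rests on one equality: if `P` is an associated prime of `M` that does not contain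
`B`, then `P` and `Ann M` have the same height. One inequality is `Ann M ≤ P`. For the other, choose
a cone `σ` with `X.hat k σ ∉ P`. Localizing at `P` turns a virtual resolution into a free resolution
of `M_P` over the regular local ring `S_P`. Since `P S_P` is associated to `M_P`, the depth of `M_P`
is zero, and the Auslander–Buchsbaum argument (`IsRegularRing.rank_height_ne_zero`) makes the term
in index `ht P` nonzero. Hence `ht P ≤ vdim M = ht (Ann M)`; this is
`height_eq_of_mem_associatedPrimes`.

The sheaf data live only in degree zero of each chart. Smoothness supplies the other degrees: every
divisor class is represented by a divisor supported off `σ`, so `S[1 / X.hat k σ]` has a unit of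
every degree (`exists_factor_hat_pow`). A map of sections therefore extends to a map `N → M[1 /
X.hat k σ]` (`exists_isExtension`), and exactness, injectivity and surjectivity carry over up to
powers of `X.hat k σ`.

The remaining modules reduce to `M`. If `N` is saturated with the sheaf of `M`, its associated
primes are associated primes of `M` not containing `B`, and `Ann N` is the saturation of `Ann M`;
the associated primes of that saturation are again of this kind. Heights become dimensions because
`ht P + dim S/P` is the number of variables for every prime `P` of a polynomial ring. -/

/-! ### Regular sequences on exact complexes and in regular local rings -/

open Pointwise in
theorem QuotSMulTop.mk_eq_mk_iff {R M : Type*} [CommRing R] [AddCommGroup M] [Module R M] {x : R}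
    {a b : M} : (Submodule.Quotient.mk a : QuotSMulTop x M) = Submodule.Quotient.mk b ↔
      ∃ u, x • u = a - b := by
  rw [Submodule.Quotient.eq, Submodule.mem_smul_pointwise_iff_exists]
  simp

theorem QuotSMulTop.map_mk {R M N : Type*} [CommRing R] [AddCommGroup M] [Module R M]
    [AddCommGroup N] [Module R N] (x : R) (f : M →ₗ[R] N) (a : M) :
    QuotSMulTop.map x f (Submodule.Quotient.mk a) = Submodule.Quotient.mk (f a) := rfl

-- This is the depth count behind Auslander–Buchsbaum. If `x • f = d 0 g`, then the class of `g`
-- satisfies the same hypotheses in the complex shifted by one and reduced modulo `x`, with one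
-- element fewer in the sequence. A solution there gives `g = d 1 z - x • u`, and cancelling `x`
-- gives `f = d 0 (-u)`. Each step uses up one term of the complex, so only the single module in
-- index `rs.length` has to vanish.
open RingTheory.Sequence in
theorem mem_range_of_forall_smul_mem_range {R : Type*} [CommRing R] (rs : List R)
    (F : ℕ → Type*) [∀ i, AddCommGroup (F i)] [∀ i, Module R (F i)]
    (d : ∀ i, F (i + 1) →ₗ[R] F i) (hd : ∀ i, Function.Exact (d (i + 1)) (d i))
    (hreg : ∀ i, IsWeaklyRegular (F i) rs) (hF : Subsingleton (F rs.length)) (f : F 0)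
    (hf : ∀ r ∈ rs, r • f ∈ LinearMap.range (d 0)) : f ∈ LinearMap.range (d 0) := by
  induction rs generalizing F with
  | nil => rw [hF.elim f 0]; exact zero_mem _
  | cons x rs ih =>
    have hx : ∀ i, IsSMulRegular (F i) x := fun i => ((isWeaklyRegular_cons_iff _ _ _).1 (hreg i)).1
    have hdd : ∀ i z, d i (d (i + 1) z) = 0 := fun i z => (hd i).apply_apply_eq_zero z
    obtain ⟨g, hg⟩ := hf x List.mem_cons_self
    have key := ih (fun i => QuotSMulTop x (F (i + 1))) (fun i => QuotSMulTop.map x (d (i + 1)))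
      (fun i => ?_) (fun i => ((isWeaklyRegular_cons_iff _ _ _).1 (hreg (i + 1))).2)
      (by
        have : Subsingleton (F (rs.length + 1)) := hF
        exact (Submodule.mkQ_surjective _).subsingleton)
      (Submodule.Quotient.mk g) (fun r hr => ?_)
    · obtain ⟨z, hz⟩ := key
      obtain ⟨z, rfl⟩ := Submodule.Quotient.mk_surjective _ z
      rw [QuotSMulTop.map_mk, QuotSMulTop.mk_eq_mk_iff] at hz
      obtain ⟨u, hu⟩ := hz
      refine ⟨-u, hx 0 ?_⟩
      beta_reduce
      rw [← map_smul, smul_neg, hu, map_neg, map_sub, hdd, zero_sub, neg_neg, hg]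
    · intro y
      obtain ⟨y, rfl⟩ := Submodule.Quotient.mk_surjective _ y
      constructor
      · intro hy
        rw [QuotSMulTop.map_mk, ← Submodule.Quotient.mk_zero, QuotSMulTop.mk_eq_mk_iff] at hy
        obtain ⟨u, hu⟩ := hy
        rw [sub_zero] at hu
        have hdu : d i u = 0 := hx i (by
          beta_reduce
          rw [← map_smul, hu, hdd, smul_zero])
        obtain ⟨w, rfl⟩ := (hd i u).1 hdu
        obtain ⟨z, hz⟩ := (hd (i + 1) (y - x • w)).1 (by rw [map_sub, map_smul, hu, sub_self])
        refine ⟨Submodule.Quotient.mk z, ?_⟩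
        rw [QuotSMulTop.map_mk, QuotSMulTop.mk_eq_mk_iff]
        exact ⟨-w, by rw [hz, sub_sub_cancel_left, smul_neg]⟩
      · rintro ⟨z, hz⟩
        obtain ⟨z, rfl⟩ := Submodule.Quotient.mk_surjective _ z
        rw [← hz, QuotSMulTop.map_mk, QuotSMulTop.map_mk, hdd, Submodule.Quotient.mk_zero]
    · obtain ⟨g', hg'⟩ := hf r (List.mem_cons_of_mem _ hr)
      obtain ⟨z, hz⟩ := (hd 0 (r • g - x • g')).1 (by
        rw [map_sub, map_smul, map_smul, hg, hg', smul_comm, sub_self])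
      refine ⟨Submodule.Quotient.mk z, ?_⟩
      rw [QuotSMulTop.map_mk, ← Submodule.Quotient.mk_smul, QuotSMulTop.mk_eq_mk_iff]
      exact ⟨-g', by rw [hz, sub_sub_cancel_left, smul_neg]⟩

-- Induction on the number of generators, dividing by a suitable `x`. Both conclusions are proved
-- together: the quotient being a domain makes `(x)` prime, which forces `R` to be a domain, and
-- that makes `x` a nonzerodivisor.
open IsLocalRing RingTheory.Sequence in
theorem isDomain_and_exists_isWeaklyRegular {n : ℕ} {R : Type*} [CommRing R] [IsLocalRing R]
    [IsNoetherianRing R] (v : Fin n → R) (hv : maximalIdeal R = Ideal.span (Set.range v))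
    (hd : (n : WithBot ℕ∞) ≤ ringKrullDim R) :
    IsDomain R ∧ ∃ rs : List R, rs.length = n ∧ (∀ r ∈ rs, r ∈ maximalIdeal R) ∧
      IsWeaklyRegular R rs := by
  induction n generalizing R with
  | zero =>
    have : IsField R := IsLocalRing.isField_iff_maximalIdeal_eq.2 (by simp [hv])
    exact ⟨this.isDomain, [], rfl, by simp, IsWeaklyRegular.nil _ _⟩
  | succ n ih =>
    have hpos : (maximalIdeal R).height ≠ 0 := by
      intro h0
      rw [← maximalIdeal_height_eq_ringKrullDim, h0] at hd
      norm_cast at hd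
    have hfin := minimalPrimes.finite_of_isNoetherianRing R
    -- Prime avoidance, which tolerates the non-prime ideal `maximalIdeal R ^ 2`. If the maximal
    -- ideal were inside its square, Nakayama would make it zero; if it were a minimal prime, its
    -- height would be zero.
    obtain ⟨x, hxm, hx⟩ : ∃ x ∈ maximalIdeal R,
        x ∉ maximalIdeal R ^ 2 ∧ ∀ q ∈ minimalPrimes R, x ∉ q := by
      by_contra! hcon
      have hsub : (maximalIdeal R : Set R) ⊆
          ⋃ q ∈ insert (maximalIdeal R ^ 2) (minimalPrimes R), (q : Set R) := by
        intro x hx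
        simp only [Set.mem_insert_iff, Set.iUnion_iUnion_eq_or_left, Set.mem_union, Set.mem_iUnion]
        by_cases h : x ∈ maximalIdeal R ^ 2
        · exact Or.inl h
        · obtain ⟨q, hq, hxq⟩ := hcon x hx h
          exact Or.inr ⟨q, hq, hxq⟩
      obtain ⟨q, hq, hle⟩ := (Ideal.subset_union_prime_finite (f := id) (hfin.insert _)
        (maximalIdeal R ^ 2) (maximalIdeal R ^ 2) (by
          rintro q (rfl | hq) h1 h2
          · exact absurd rfl h1
          · exact hq.1.1)).1 hsub
      rcases hq with rfl | hq
      · refine hpos ?_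
        have : maximalIdeal R = ⊥ := Submodule.eq_bot_of_le_smul_of_le_jacobson_bot
          (maximalIdeal R) _ (IsNoetherian.noetherian _) (by simpa [pow_two] using hle)
          (IsLocalRing.maximalIdeal_le_jacobson _)
        rw [this, Ideal.height_bot]
      · have hqp : q.IsPrime := hq.1.1
        have : q = maximalIdeal R := le_antisymm (le_maximalIdeal hqp.ne_top) hle
        exact hpos (this ▸ Ideal.height_eq_zero_iff.2 hq)
    obtain ⟨hx2, hxq⟩ := hx
    obtain ⟨a, ha⟩ := Ideal.mem_span_range_iff_exists_fun.1 (hv ▸ hxm)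
    obtain ⟨i, hi⟩ : ∃ i, IsUnit (a i) := by
      by_contra! hcon
      refine hx2 (ha ▸ Ideal.sum_mem _ fun i _ => ?_)
      rw [pow_two]
      exact Ideal.mul_mem_mul (hcon i) (hv ▸ Ideal.subset_span ⟨i, rfl⟩)
    have hne : Ideal.span {x} ≠ ⊤ := fun h =>
      (maximalIdeal.isMaximal R).ne_top (top_le_iff.1 (h ▸ (Ideal.span_singleton_le_iff_mem _).2 hxm))
    have : Nontrivial (R ⧸ Ideal.span {x}) := Ideal.Quotient.nontrivial_iff.2 hne
    have hloc : IsLocalRing (R ⧸ Ideal.span {x}) :=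
      IsLocalRing.of_surjective' (Ideal.Quotient.mk _) Ideal.Quotient.mk_surjective
    have hmap : maximalIdeal (R ⧸ Ideal.span {x}) =
        (maximalIdeal R).map (Ideal.Quotient.mk (Ideal.span {x})) := by
      symm
      refine IsLocalRing.eq_maximalIdeal ?_
      refine (Ideal.map_eq_top_or_isMaximal_of_surjective _ Ideal.Quotient.mk_surjective
        (maximalIdeal.isMaximal R)).resolve_left fun h => ?_
      have := Ideal.comap_map_of_surjective' (Ideal.Quotient.mk (Ideal.span {x}))
        Ideal.Quotient.mk_surjective (maximalIdeal R)
      rw [h, Ideal.mk_ker, sup_eq_left.2 ((Ideal.span_singleton_le_iff_mem _).2 hxm)] at this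
      exact (maximalIdeal.isMaximal R).ne_top (by rw [← this]; simp)
    -- As `x` lies outside the square, some coefficient `a i` in `x = ∑ a l * v l` is a unit, so `v
    -- i` is redundant modulo `x`.
    have hgen : maximalIdeal (R ⧸ Ideal.span {x}) =
        Ideal.span (Set.range fun j => Ideal.Quotient.mk (Ideal.span {x}) (v (i.succAbove j))) := by
      refine hmap.trans (le_antisymm ?_ ?_)
      · rw [hv, Ideal.map_span, Ideal.span_le]
        rintro _ ⟨_, ⟨j, rfl⟩, rfl⟩
        have hother : ∀ l, Ideal.Quotient.mk (Ideal.span {x}) (v (i.succAbove l)) ∈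
            Ideal.span (Set.range fun j =>
              Ideal.Quotient.mk (Ideal.span {x}) (v (i.succAbove j))) :=
          fun l => Ideal.subset_span ⟨l, rfl⟩
        rcases Fin.eq_self_or_eq_succAbove i j with rfl | ⟨l, rfl⟩
        · have h0 : Ideal.Quotient.mk (Ideal.span {x}) (∑ l, a l * v l) = 0 := by
            rw [ha]
            exact Ideal.Quotient.eq_zero_iff_mem.2 (Ideal.mem_span_singleton_self x)
          rw [Fin.sum_univ_succAbove _ j, map_add, map_mul, map_sum] at h0
          have hmem : Ideal.Quotient.mk (Ideal.span {x}) (a j) *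
              Ideal.Quotient.mk (Ideal.span {x}) (v j) ∈ Ideal.span (Set.range fun l =>
                Ideal.Quotient.mk (Ideal.span {x}) (v (j.succAbove l))) := by
            rw [eq_neg_of_add_eq_zero_left h0]
            refine neg_mem (sum_mem fun l _ => ?_)
            rw [map_mul]
            exact Ideal.mul_mem_left _ _ (hother l)
          exact (Ideal.unit_mul_mem_iff_mem _ (hi.map _)).1 hmem
        · exact hother l
      · rw [Ideal.span_le]
        rintro _ ⟨j, rfl⟩
        exact Ideal.mem_map_of_mem _ (hv ▸ Ideal.subset_span ⟨_, rfl⟩)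
    have hdim : (n : WithBot ℕ∞) ≤ ringKrullDim (R ⧸ Ideal.span {x}) := by
      have h1 := Ideal.height_le_ringKrullDim_quotient_add_one (p := maximalIdeal R) hxm
      rw [maximalIdeal_height_eq_ringKrullDim] at h1
      have h2 := hd.trans h1
      rw [← maximalIdeal_height_eq_ringKrullDim] at h2 ⊢
      norm_cast at h2 ⊢
      push_cast at h2
      exact (ENat.add_le_add_iff_right ENat.one_ne_top).1 h2
    obtain ⟨hdom, rs', hlen, hmem, hreg⟩ := ih _ hgen hdim
    have hxp : (Ideal.span {x}).IsPrime := (Ideal.Quotient.isDomain_iff_prime _).1 hdom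
    -- A minimal prime `q` inside the prime `(x)` does not contain `x`, so `q = x q` and Nakayama
    -- gives `q = 0`.
    have hRdom : IsDomain R := by
      obtain ⟨q, hq, hqx⟩ := Ideal.exists_minimalPrimes_le (I := ⊥) (J := Ideal.span {x}) bot_le
      have hqp : q.IsPrime := hq.1.1
      have hq0 : q = ⊥ := by
        refine Submodule.eq_bot_of_le_smul_of_le_jacobson_bot
          (maximalIdeal R) _ (IsNoetherian.noetherian _) ?_ (IsLocalRing.maximalIdeal_le_jacobson _)
        intro y hy
        obtain ⟨z, rfl⟩ := Ideal.mem_span_singleton'.1 (hqx hy)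
        have hz : z ∈ q := (hqp.mem_or_mem hy).resolve_right (hxq q hq)
        rw [mul_comm]
        exact Ideal.mul_mem_mul hxm hz
      rw [hq0] at hqp
      exact IsDomain.of_bot_isPrime R
    refine ⟨hRdom, ?_⟩
    have hx0 : x ≠ 0 := fun h => hx2 (h ▸ zero_mem _)
    obtain ⟨rs, rfl⟩ := List.map_surjective_iff.2 (Ideal.Quotient.mk_surjective (I := Ideal.span {x})) rs'
    refine ⟨x :: rs, by simpa using hlen, ?_, ?_⟩
    · simp only [List.mem_cons, forall_eq_or_imp]
      refine ⟨hxm, fun r hr => ?_⟩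
      have := hmem _ (List.mem_map_of_mem hr)
      by_contra hr'
      exact this ((IsLocalRing.notMem_maximalIdeal.1 hr').map _)
    · rw [isWeaklyRegular_cons_iff]
      refine ⟨fun a b h => mul_left_cancel₀ hx0 h, ?_⟩
      have h1 : IsWeaklyRegular (R ⧸ Ideal.span {x}) rs :=
        (isWeaklyRegular_map_algebraMap_iff (R ⧸ Ideal.span {x}) (R ⧸ Ideal.span {x}) rs).1 hreg
      refine (LinearEquiv.isWeaklyRegular_congr (Submodule.quotEquivOfEq _ _ ?_) rs).2 h1
      rw [← Submodule.ideal_span_singleton_smul, smul_eq_mul, Ideal.mul_top]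

theorem IsRegularLocalRing.exists_isWeaklyRegular (R : Type*) [CommRing R] [IsRegularLocalRing R]
    (n : ℕ) (hn : (n : WithBot ℕ∞) = ringKrullDim R) :
    ∃ rs : List R, rs.length = n ∧ (∀ r ∈ rs, r ∈ IsLocalRing.maximalIdeal R) ∧
      RingTheory.Sequence.IsWeaklyRegular R rs := by
  have hs := (isRegularLocalRing_iff R).1 ‹_›
  obtain ⟨s, hc, hsp⟩ := Submodule.FG.exists_span_finset_card_eq_spanFinrank
    (IsNoetherian.noetherian (IsLocalRing.maximalIdeal R))
  have hcn : s.card = n := by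
    rw [hc]; exact_mod_cast hs.trans hn.symm
  refine (isDomain_and_exists_isWeaklyRegular
    (fun i => ((s.equivFinOfCardEq hcn).symm i : R)) ?_ hn.le).2
  rw [← hsp, Set.range_comp' Subtype.val, (s.equivFinOfCardEq hcn).symm.range_eq_univ]
  simp [Ideal.span]

/-! ### Heights and dimensions in polynomial rings -/

/-- The dimension bounds the height above. For the lower bound one variable is split off: by the
Jacobson property a maximal ideal contracts to a maximal ideal, and its height exceeds that of the
contraction by one. -/
theorem MvPolynomial.height_of_isMaximal {ι k : Type*} [Finite ι] [Field k]
    (m : Ideal (MvPolynomial ι k)) [hm : m.IsMaximal] : m.height = Nat.card ι := by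
  refine le_antisymm ?_ ?_
  · have := Ideal.height_le_ringKrullDim_of_ne_top hm.ne_top
    rw [MvPolynomial.ringKrullDim_of_isNoetherianRing, ringKrullDim_eq_zero_of_field,
      zero_add] at this
    exact_mod_cast this
  · induction ι using Finite.induction_empty_option with
    | of_equiv e ih =>
      have := ih (m.comap (renameEquiv k e).toRingEquiv)
        (hm := Ideal.comap_isMaximal_of_equiv (renameEquiv k e).toRingEquiv)
      rwa [RingEquiv.height_comap, Nat.card_congr e] at this
    | h_empty => simp
    | @h_option ι _ ih =>
      let e := (MvPolynomial.optionEquivLeft k ι).toRingEquiv.symm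
      have hm' : (m.comap e).IsMaximal := Ideal.comap_isMaximal_of_equiv e
      have hn : ((m.comap e).comap Polynomial.C).IsMaximal :=
        Polynomial.isMaximal_comap_C_of_isJacobsonRing _
      have : (m.comap e).LiesOver ((m.comap e).comap Polynomial.C) := ⟨rfl⟩
      have h1 := Polynomial.height_eq_height_add_one ((m.comap e).comap Polynomial.C) (m.comap e)
      rw [RingEquiv.height_comap] at h1
      rw [h1, Nat.card_eq_fintype_card (α := Option ι), Fintype.card_option, Nat.cast_add,
        Nat.cast_one, ← Nat.card_eq_fintype_card]
      gcongr
      exact ih _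

/-- Geometrically, a closed point on one component of `V(I)` and on no other. Some `g ∉ P` lies in
all other minimal primes, and since `P` is an intersection of maximal ideals, one of these avoids
`g`. -/
theorem Ideal.exists_isMaximal_forall_le_of_mem_minimalPrimes {R : Type*} [CommRing R]
    [IsNoetherianRing R] [IsJacobsonRing R] {I P : Ideal R} (hP : P ∈ I.minimalPrimes) :
    ∃ m : Ideal R, m.IsMaximal ∧ P ≤ m ∧ ∀ Q : Ideal R, Q.IsPrime → I ≤ Q → Q ≤ m → P ≤ Q := by
  have hPp : P.IsPrime := hP.1.1
  have hfin := I.finite_minimalPrimes_of_isNoetherianRing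
  obtain ⟨g, hg, hgP⟩ : ∃ g ∈ (hfin.toFinset.erase P).inf id, g ∉ P := by
    refine SetLike.not_le_iff_exists.1 fun h => ?_
    obtain ⟨Q, hQ, hQP⟩ := (Ideal.IsPrime.inf_le' hPp).1 h
    simp only [Finset.mem_erase, Set.Finite.mem_toFinset] at hQ
    exact hQ.1 (le_antisymm hQP (hP.2 hQ.2.1 hQP))
  obtain ⟨m, ⟨hPm, hm⟩, hgm⟩ : ∃ m ∈ {J : Ideal R | P ≤ J ∧ J.IsMaximal}, g ∉ m := by
    have := IsJacobsonRing.out' P hPp.isRadical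
    rw [Ideal.jacobson] at this
    by_contra! hcon
    exact hgP (this ▸ Submodule.mem_sInf.2 hcon)
  refine ⟨m, hm, hPm, fun Q hQ hIQ hQm => ?_⟩
  obtain ⟨q, hq, hqQ⟩ := Ideal.exists_minimalPrimes_le hIQ
  by_cases h : q = P
  · exact h ▸ hqQ
  · refine absurd (hQm (hqQ ?_)) hgm
    exact (Finset.inf_le (f := id) (by simp [h, hq]) : _ ≤ q) hg

/-- Make `P` minimal over an ideal `I` with `ht P` generators and take `m` above `P` and above no
other component of `V(I)`. Passing to `S/I` lowers the height of `m` by at most `ht P`, and a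
longest chain below `m` in `S/I` is forced to lie above `P`. -/
theorem MvPolynomial.card_le_height_add_ringKrullDim_quotient {ι k : Type*} [Finite ι] [Field k]
    (P : Ideal (MvPolynomial ι k)) [hP : P.IsPrime] :
    (Nat.card ι : WithBot ℕ∞) ≤ P.height + ringKrullDim (MvPolynomial ι k ⧸ P) := by
  obtain ⟨s, hs, hcard⟩ := P.exists_finset_card_eq_height_of_isNoetherianRing
  obtain ⟨m, hm, hPm, hmin⟩ := Ideal.exists_isMaximal_forall_le_of_mem_minimalPrimes hs
  set I := Ideal.span (s : Set (MvPolynomial ι k)) with hI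
  have hIm : I ≤ m := hs.1.2.trans hPm
  have h1 := Ideal.height_le_height_add_encard_of_subset (s : Set (MvPolynomial ι k)) (p := m)
    (Ideal.span_le.1 hIm)
  rw [MvPolynomial.height_of_isMaximal, Set.encard_coe_eq_coe_finsetCard, hcard] at h1
  have : (m.map (Ideal.Quotient.mk I)).IsPrime := Ideal.isPrime_map_quotientMk_of_isPrime hIm
  obtain ⟨l, hl, hlen⟩ := (m.map (Ideal.Quotient.mk I)).exists_ltSeries_length_eq_height
  have hmc : (m.map (Ideal.Quotient.mk I)).comap (Ideal.Quotient.mk I) = m := by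
    rw [Ideal.comap_map_of_surjective' _ Ideal.Quotient.mk_surjective, Ideal.mk_ker,
      sup_eq_left.2 hIm]
  let l' : LTSeries (PrimeSpectrum (MvPolynomial ι k)) :=
    l.map (PrimeSpectrum.comap (Ideal.Quotient.mk I))
      (RingHom.strictMono_comap_of_surjective Ideal.Quotient.mk_surjective)
  have hlast : l'.last.asIdeal = m := by
    simp only [l', LTSeries.last_map, PrimeSpectrum.comap_asIdeal, hl, hmc]
  have hhead : P ≤ l'.head.asIdeal := by
    refine hmin _ l'.head.2 ?_ ?_
    · simp only [l', LTSeries.head_map, PrimeSpectrum.comap_asIdeal]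
      exact Ideal.mk_ker.ge.trans (Ideal.comap_mono bot_le)
    · exact hlast ▸ l'.head_le_last
  have h2 : (l.length : WithBot ℕ∞) ≤ ringKrullDim (MvPolynomial ι k ⧸ P) := by
    rw [ringKrullDim_quotient]
    let l'' : LTSeries (PrimeSpectrum.zeroLocus (P : Set (MvPolynomial ι k))) :=
      { length := l'.length
        toFun := fun i => ⟨l' i, hhead.trans (l'.monotone (Fin.zero_le i))⟩
        step := fun i => l'.step i }
    exact Order.LTSeries.length_le_krullDim l''
  have h3 : (Nat.card ι : WithBot ℕ∞) ≤ (l.length : WithBot ℕ∞) + P.height := by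
    rw [← hlen] at h1
    exact_mod_cast h1
  refine h3.trans ?_
  rw [add_comm]
  gcongr

/-- A chain in `Z` starts at a prime of height at least `ht P`, so its length is at most the number
of variables minus `ht P`, which `dim S/P` attains. Only upward closure of `Z` is needed, so this
applies to supports of modules that are not finitely generated. -/
theorem MvPolynomial.krullDim_eq_ringKrullDim_quotient {ι k : Type*} [Finite ι] [Field k]
    (Z : Set (PrimeSpectrum (MvPolynomial ι k))) (hZ : IsUpperSet Z)
    (P : PrimeSpectrum (MvPolynomial ι k)) (hP : P ∈ Z)
    (hmin : ∀ Q ∈ Z, P.asIdeal.height ≤ Q.asIdeal.height) :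
    ringKrullDim (MvPolynomial ι k ⧸ P.asIdeal) = Order.krullDim Z := by
  refine le_antisymm ?_ ?_
  · rw [ringKrullDim_quotient]
    exact Order.krullDim_le_of_strictMono
      (fun Q => ⟨Q.1, hZ (show P ≤ Q.1 from Q.2) hP⟩) fun _ _ h => h
  · refine iSup_le fun l => ?_
    have h1 := MvPolynomial.card_le_height_add_ringKrullDim_quotient P.asIdeal
    let l' : LTSeries (PrimeSpectrum (MvPolynomial ι k)) := l.map Subtype.val fun _ _ h => h
    have h2 : Order.height l'.head + Order.coheight l'.head ≤ (Nat.card ι : ℕ∞) := by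
      have := Order.krullDim_eq_iSup_height_add_coheight_of_nonempty
        (α := PrimeSpectrum (MvPolynomial ι k))
      have h3 : ringKrullDim (MvPolynomial ι k) = _ := this
      rw [MvPolynomial.ringKrullDim_of_isNoetherianRing, ringKrullDim_eq_zero_of_field,
        zero_add] at h3
      have h4 := le_iSup (fun a : PrimeSpectrum (MvPolynomial ι k) =>
        Order.height a + Order.coheight a) l'.head
      refine h4.trans ?_
      exact_mod_cast h3.ge
    have h3 : (l.length : ℕ∞) ≤ Order.coheight l'.head := Order.length_le_coheight le_rfl
    have h4 : P.asIdeal.height ≤ Order.height l'.head := by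
      rw [← PrimeSpectrum.height_eq_orderHeight]
      exact hmin _ (l.head).2
    have hfin : P.asIdeal.height ≠ ⊤ := Ideal.height_ne_top_of_isPrime
    have h5 : P.asIdeal.height + (l.length : ℕ∞) ≤ (Nat.card ι : ℕ∞) :=
      (add_le_add h4 h3).trans h2
    have h6 : ((P.asIdeal.height + (l.length : ℕ∞) : ℕ∞) : WithBot ℕ∞) ≤
        P.asIdeal.height + ringKrullDim (MvPolynomial ι k ⧸ P.asIdeal) :=
      le_trans (by exact_mod_cast h5) h1
    have h7 : ringKrullDim (MvPolynomial ι k ⧸ P.asIdeal) ≠ ⊥ := by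
      rw [ringKrullDim, ne_eq, Order.krullDim_eq_bot_iff, not_isEmpty_iff]
      infer_instance
    revert h6
    generalize ringKrullDim (MvPolynomial ι k ⧸ P.asIdeal) = D at h7
    obtain ⟨D, rfl⟩ := WithBot.ne_bot_iff_exists.1 h7
    intro h6
    norm_cast at h6 ⊢
    exact (ENat.add_le_add_iff_left hfin).1 h6

/-! ### The Auslander–Buchsbaum inequality at a prime -/

theorem RingTheory.Sequence.IsWeaklyRegular.of_flat_module {R M : Type*} [CommRing R]
    [AddCommGroup M] [Module R M] [Module.Flat R M] {rs : List R}
    (h : IsWeaklyRegular R rs) : IsWeaklyRegular M rs :=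
  (LinearEquiv.isWeaklyRegular_congr (TensorProduct.rid R M) rs).1 (IsWeaklyRegular.isWeaklyRegular_lTensor (M₂ := M) h)

theorem LocalizedModule.mk_eq_zero_iff {R M : Type*} [CommRing R] [AddCommGroup M] [Module R M]
    {S : Submonoid R} {m : M} {s : S} : LocalizedModule.mk m s = 0 ↔ ∃ u : S, u • m = 0 := by
  rw [IsLocalizedModule.mk_eq_mk', IsLocalizedModule.mk'_eq_zero']

open RingTheory.Sequence in
/-- A form of the Auslander--Buchsbaum inequality at a prime `P`. -/
theorem IsRegularRing.rank_height_ne_zero {S : Type*} [CommRing S] [IsRegularRing S]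
    (P : Ideal S) [hP : P.IsPrime] (h : ℕ) (hh : P.height = h) (rank : ℕ → ℕ)
    (d : ∀ i, (Fin (rank (i + 1)) → S) →ₗ[S] (Fin (rank i) → S))
    (hdd : ∀ i, d i ∘ₗ d (i + 1) = 0)
    (hd : ∀ i f, d i f = 0 → ∃ s ∉ P, s • f ∈ LinearMap.range (d (i + 1)))
    (f : Fin (rank 0) → S) (hf : ∀ a ∈ P, ∃ s ∉ P, s • a • f ∈ LinearMap.range (d 0))
    (hf' : ∀ s ∉ P, s • f ∉ LinearMap.range (d 0)) : rank h ≠ 0 := by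
  intro hrank
  -- The localization at `P` is regular of dimension `h`, so it carries a regular sequence of
  -- exactly the length at which the complex is assumed to vanish.
  obtain ⟨rs, hlen, hmem, hreg⟩ :=
    IsRegularLocalRing.exists_isWeaklyRegular (Localization.AtPrime P) h (by
      rw [IsLocalization.AtPrime.ringKrullDim_eq_height P, hh]; rfl)
  let F : ℕ → Type _ := fun i => LocalizedModule P.primeCompl (Fin (rank i) → S)
  let D : ∀ i, F (i + 1) →ₗ[Localization.AtPrime P] F i :=
    fun i => LocalizedModule.map P.primeCompl (d i)
  have hD : ∀ i a s, D i (LocalizedModule.mk a s) = LocalizedModule.mk (d i a) s :=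
    fun i a s => LocalizedModule.map_mk _ _ _ _
  have key := mem_range_of_forall_smul_mem_range rs F D ?_ ?_ ?_
    (LocalizedModule.mk f 1) ?_
  · obtain ⟨z, hz⟩ := key
    induction z using LocalizedModule.induction_on with
    | _ g t =>
      rw [hD, LocalizedModule.mk_eq] at hz
      obtain ⟨u, hu⟩ := hz
      refine hf' (u * t : P.primeCompl) (u * t).2 ⟨(u : S) • g, ?_⟩
      simp only [Submonoid.smul_def, one_smul] at hu
      rw [map_smul, hu, Submonoid.coe_mul, mul_smul]
  · intro i z
    induction z using LocalizedModule.induction_on with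
    | _ g t =>
      rw [hD]
      constructor
      · intro h0
        rw [LocalizedModule.mk_eq_zero_iff] at h0
        obtain ⟨u, hu⟩ := h0
        have hu' : d i ((u : S) • g) = 0 := by rw [map_smul]; exact hu
        obtain ⟨s, hs, w, hw⟩ := hd i _ hu'
        refine ⟨LocalizedModule.mk w (⟨s, hs⟩ * u * t), ?_⟩
        rw [hD, hw, LocalizedModule.mk_eq]
        refine ⟨1, ?_⟩
        simp only [Submonoid.smul_def, one_smul, Submonoid.coe_mul, smul_smul]
        congr 1; ring
      · rintro ⟨z, hz⟩
        induction z using LocalizedModule.induction_on with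
        | _ w t' =>
          rw [← hD, ← hz, hD, hD, ← LinearMap.comp_apply, hdd, LinearMap.zero_apply,
            LocalizedModule.zero_mk]
  · intro i
    have : Module.Free (Localization.AtPrime P) (F i) :=
      Module.free_of_isLocalizedModule P.primeCompl
        (LocalizedModule.mkLinearMap P.primeCompl (Fin (rank i) → S))
    exact hreg.of_flat_module
  · rw [hlen]
    have : IsEmpty (Fin (rank h)) := by rw [hrank]; infer_instance
    refine ⟨fun a b => ?_⟩
    induction a using LocalizedModule.induction_on with
    | _ a s =>
      induction b using LocalizedModule.induction_on with
      | _ b t => rw [Subsingleton.elim a 0, Subsingleton.elim b 0, LocalizedModule.zero_mk,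
          LocalizedModule.zero_mk]
  · intro r hr
    have hr := hmem r hr
    obtain ⟨a, t, rfl⟩ := IsLocalization.exists_mk'_eq P.primeCompl r
    have ha : a ∈ P := (IsLocalization.AtPrime.mk'_mem_maximal_iff _ P a t).1 hr
    obtain ⟨s, hs, w, hw⟩ := hf a ha
    refine ⟨LocalizedModule.mk w ((⟨s, hs⟩ : P.primeCompl) * t), ?_⟩
    rw [hD, hw, ← Localization.mk_eq_mk'_apply, LocalizedModule.mk_smul_mk, LocalizedModule.mk_eq]
    refine ⟨1, ?_⟩
    simp only [Submonoid.smul_def, OneMemClass.coe_one, one_smul, Submonoid.coe_mul, smul_smul]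
    congr 1; ring

/-! ### Units of every degree on a chart, and extension of maps to all degrees -/

namespace SmoothProjectiveFan

variable {n : ℕ} {ι : Type*} [Fintype ι] [DecidableEq ι] (X : SmoothProjectiveFan n ι)
  (k : Type*) [Field k]

variable {k} in
theorem mul_mem_of_mem {a b : X.Cox k} {d e f : X.Pic} (ha : a ∈ X.grading k d)
    (hb : b ∈ X.grading k e) (h : d + e = f) : a * b ∈ X.grading k f :=
  h ▸ SetLike.mul_mem_graded ha hb

/-- The degrees `d` for which `X.hat k σ` has a power that factors into homogeneous elements whose
degrees are `-d` and `d` modulo multiples of the degree of `X.hat k σ`. -/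
def factorDegrees (σ : Finset ι) : AddSubgroup X.Pic where
  carrier := {d | ∃ (t t' : ℕ), ∃ u ∈ X.grading k (t • X.hatDeg σ - d),
    ∃ v ∈ X.grading k (t' • X.hatDeg σ + d), u * v = X.hat k σ ^ (t + t')}
  zero_mem' := ⟨0, 0, 1, by simpa using SetLike.one_mem_graded (X.grading k), 1,
    by simpa using SetLike.one_mem_graded (X.grading k), by simp⟩
  add_mem' := by
    rintro d e ⟨t, t', u, hu, v, hv, h⟩ ⟨s, s', w, hw, y, hy, h'⟩
    refine ⟨t + s, t' + s', u * w, X.mul_mem_of_mem hu hw (by rw [add_smul]; abel),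
      v * y, X.mul_mem_of_mem hv hy (by rw [add_smul]; abel), ?_⟩
    rw [mul_mul_mul_comm, h, h', ← pow_add]; congr 1; ring
  neg_mem' := by
    rintro d ⟨t, t', u, hu, v, hv, h⟩
    refine ⟨t', t, v, by rwa [sub_neg_eq_add], u, by rwa [← sub_eq_add_neg], ?_⟩
    rw [mul_comm, h, add_comm]

theorem varDeg_mem_factorDegrees {σ : Finset ι} {ρ : ι} (hρ : ρ ∉ σ) :
    X.varDeg ρ ∈ X.factorDegrees k σ := by
  have hmem : ρ ∈ σᶜ := Finset.mem_compl.2 hρ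
  refine ⟨1, 0, ∏ τ ∈ σᶜ.erase ρ, MvPolynomial.X τ, ?_, MvPolynomial.X ρ, ?_, ?_⟩
  · have h : (1 : ℕ) • X.hatDeg σ - X.varDeg ρ = ∑ τ ∈ σᶜ.erase ρ, X.varDeg τ := by
      rw [one_smul, hatDeg, ← Finset.add_sum_erase _ _ hmem, add_sub_cancel_left]
    rw [h]
    exact SetLike.prod_mem_graded (A := X.grading k) X.varDeg _
      fun ρ _ => MvPolynomial.isWeightedHomogeneous_X k X.varDeg ρ
  · rw [zero_smul, zero_add]
    exact MvPolynomial.isWeightedHomogeneous_X k X.varDeg ρ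
  · rw [Finset.prod_erase_mul _ _ hmem, add_zero, pow_one, hat]

theorem mk_eq_sum_varDeg (D : ι → ℤ) :
    (Submodule.Quotient.mk D : X.Pic) = ∑ ρ, D ρ • X.varDeg ρ := by
  have h : D = ∑ ρ, D ρ • (Pi.single ρ 1 : ι → ℤ) := by
    ext τ; simp [Finset.sum_apply, Pi.single_apply]
  conv_lhs => rw [h]
  simp only [varDeg, ← Submodule.mkQ_apply, map_sum, map_smul]

/-- This says that line bundles are trivial on `U_σ`, and it is where smoothness enters. The
variables off `σ` divide `X.hat k σ`; for a ray in `σ`, a character moves its divisor off `σ`. -/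
theorem factorDegrees_eq_top {σ : Finset ι} (hσ : σ ∈ X.cones) : X.factorDegrees k σ = ⊤ := by
  refine (AddSubgroup.eq_top_iff' _).2 fun d => ?_
  obtain ⟨D, rfl⟩ := Submodule.Quotient.mk_surjective _ d
  rw [mk_eq_sum_varDeg]
  refine sum_mem fun ρ _ => zsmul_mem ?_ _
  by_cases hρ : ρ ∈ σ
  · obtain ⟨b, e, he, hb⟩ := X.smooth σ hσ
    -- The dual basis vector at `gen ρ`: it takes the value one there and zero on the other rays of
    -- `σ`, so its principal divisor expresses `D_ρ` through divisors off `σ`.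
    let m : Fin n → ℤ := fun i => b.coord (e ρ) (Pi.single i 1)
    have hm : ∀ τ, X.divMap m τ = b.coord (e ρ) (X.gen τ) := by
      intro τ
      have h : X.gen τ = ∑ i, X.gen τ i • (Pi.single i 1 : Fin n → ℤ) := by
        ext j; simp [Finset.sum_apply, Pi.single_apply]
      conv_rhs => rw [h]
      simp only [map_sum, map_smul, smul_eq_mul]
      rfl
    have h0 : (Submodule.Quotient.mk (X.divMap m) : X.Pic) = 0 :=
      (Submodule.Quotient.mk_eq_zero _).2 ⟨m, rfl⟩
    rw [mk_eq_sum_varDeg, ← Finset.add_sum_erase _ _ (Finset.mem_univ ρ), hm ρ, ← hb ρ hρ] at h0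
    simp only [Module.Basis.coord_apply, Module.Basis.repr_self, Finsupp.single_eq_same,
      one_smul] at h0
    rw [eq_neg_of_add_eq_zero_left h0]
    refine neg_mem (sum_mem fun τ hτ => ?_)
    by_cases hτσ : τ ∈ σ
    · rw [hm, ← hb τ hτσ, Module.Basis.coord_apply, Module.Basis.repr_self,
        Finsupp.single_eq_of_ne, zero_smul]
      · exact zero_mem _
      · exact fun h => (Finset.mem_erase.1 hτ).1 (he hτσ hρ h.symm)
    · exact zsmul_mem (X.varDeg_mem_factorDegrees k hτσ) _
  · exact X.varDeg_mem_factorDegrees k hρ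

theorem exists_factor_hat_pow {σ : Finset ι} (hσ : σ ∈ X.cones) (d : X.Pic) :
    ∃ (t t' : ℕ), ∃ u ∈ X.grading k (t • X.hatDeg σ - d),
      ∃ v ∈ X.grading k (t' • X.hatDeg σ + d), u * v = X.hat k σ ^ (t + t') := by
  have : d ∈ X.factorDegrees k σ := by rw [X.factorDegrees_eq_top k hσ]; trivial
  exact this

variable {k} {M : Type*} [AddCommGroup M] [Module (X.Cox k) M]

theorem hat_pow_smul_injective (σ : Finset ι) (j : ℕ) :
    Function.Injective fun z : LocalizedModule (X.hatPowers k σ) M => X.hat k σ ^ j • z := by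
  have h := IsLocalizedModule.map_units
    (LocalizedModule.mkLinearMap (X.hatPowers k σ) M) (X.hatPow k σ j)
  exact ((Module.End.isUnit_iff _).1 h).1

theorem hat_pow_smul_mk (σ : Finset ι) (j : ℕ) (m : M) :
    X.hat k σ ^ j • (LocalizedModule.mk m (X.hatPow k σ j) : LocalizedModule (X.hatPowers k σ) M) =
      LocalizedModule.mk m 1 := by
  rw [LocalizedModule.smul'_mk]
  exact LocalizedModule.mk_cancel (X.hatPow k σ j) m

theorem mk_one_eq_zero_iff {σ : Finset ι} {m : M} :
    (LocalizedModule.mk m 1 : LocalizedModule (X.hatPowers k σ) M) = 0 ↔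
      ∃ j, X.hat k σ ^ j • m = 0 := by
  rw [LocalizedModule.mk_eq_zero_iff]
  constructor
  · rintro ⟨⟨_, j, rfl⟩, h⟩
    exact ⟨j, h⟩
  · rintro ⟨j, h⟩
    exact ⟨X.hatPow k σ j, h⟩

theorem exists_hat_pow_smul_eq_mk {σ : Finset ι} (z : LocalizedModule (X.hatPowers k σ) M) :
    ∃ j m, X.hat k σ ^ j • z = LocalizedModule.mk m 1 := by
  induction z using LocalizedModule.induction_on with
  | _ m s =>
    obtain ⟨_, j, rfl⟩ := s
    exact ⟨j, m, X.hat_pow_smul_mk σ j m⟩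

variable {ℳ : X.Pic → AddSubgroup M} [SetLike.GradedSMul (X.grading k) ℳ]
variable {N : Type*} [AddCommGroup N] [Module (X.Cox k) N]
variable {𝒩 : X.Pic → AddSubgroup N} [SetLike.GradedSMul (X.grading k) 𝒩]

theorem smul_mem_of_mem {a : X.Cox k} {m : M} {d e f : X.Pic} (ha : a ∈ X.grading k d)
    (hm : m ∈ ℳ e) (h : d + e = f) : a • m ∈ ℳ f :=
  h ▸ SetLike.GradedSMul.smul_mem ha hm

variable (k ℳ) in
/-- The section `m / (X.hat k σ) ^ t` of the sheaf associated to a graded module. -/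
noncomputable def sectionMk (σ : Finset ι) (t : ℕ) (m : M) (hm : m ∈ ℳ (t • X.hatDeg σ)) :
    X.sections k ℳ σ :=
  ⟨LocalizedModule.mk m (X.hatPow k σ t), t, m, hm, rfl⟩

theorem exists_eq_sectionMk {σ : Finset ι} (z : X.sections k ℳ σ) :
    ∃ t m hm, z = X.sectionMk k ℳ σ t m hm := by
  obtain ⟨_, t, m, hm, rfl⟩ := z
  exact ⟨t, m, hm, rfl⟩

/-- Linearity of `φ` over the chart ring, applied to the scalar `a / X.hat k σ ^ t'`, with the
denominator cleared. -/
theorem hat_pow_smul_map_sectionMk {σ : Finset ι}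
    (φ : X.sections k 𝒩 σ →ₗ[X.chartRing k σ] X.sections k ℳ σ) {t t' : ℕ} {x : N}
    (hx : x ∈ 𝒩 (t • X.hatDeg σ)) {a : X.Cox k} (ha : a ∈ X.grading k (t' • X.hatDeg σ))
    {s : ℕ} {y : N} (hy : y ∈ 𝒩 (s • X.hatDeg σ)) (hs : s = t' + t) (hyx : y = a • x) :
    X.hat k σ ^ t' • (φ (X.sectionMk k 𝒩 σ s y hy)).1 = a • (φ (X.sectionMk k 𝒩 σ t x hx)).1 := by
  subst hs hyx
  let r : X.chartRing k σ := ⟨Localization.mk a (X.hatPow k σ t'), t', a, ha, rfl⟩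
  have h1 : (φ (X.sectionMk k 𝒩 σ (t' + t) (a • x) hy)).1 =
      Localization.mk a (X.hatPow k σ t') • (φ (X.sectionMk k 𝒩 σ t x hx)).1 := by
    refine congrArg Subtype.val
      ((congrArg φ (Subtype.ext ?_)).trans (φ.map_smul r (X.sectionMk k 𝒩 σ t x hx)))
    change LocalizedModule.mk (a • x) (X.hatPow k σ (t' + t)) =
      Localization.mk a (X.hatPow k σ t') • LocalizedModule.mk x (X.hatPow k σ t)
    rw [LocalizedModule.mk_smul_mk, hatPow_mul]
  rw [h1]
  generalize (φ (X.sectionMk k 𝒩 σ t x hx)).1 = z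
  induction z using LocalizedModule.induction_on with
  | _ m w =>
    rw [LocalizedModule.mk_smul_mk, LocalizedModule.smul'_mk, LocalizedModule.smul'_mk]
    exact LocalizedModule.mk_cancel_common_left (X.hatPow k σ t') w (a • m)

/-- `Φ` extends the map `φ` on sections over `U_σ` to all degrees. -/
def IsExtension {σ : Finset ι} (φ : X.sections k 𝒩 σ →ₗ[X.chartRing k σ] X.sections k ℳ σ)
    (Φ : N →ₗ[X.Cox k] LocalizedModule (X.hatPowers k σ) M) : Prop :=
  ∀ (d : X.Pic) (t : ℕ) (s : X.Cox k) (x : N), s ∈ X.grading k (t • X.hatDeg σ - d) → x ∈ 𝒩 d →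
    ∀ h : s • x ∈ 𝒩 (t • X.hatDeg σ),
      s • Φ x = X.hat k σ ^ t • (φ (X.sectionMk k 𝒩 σ t (s • x) h)).1

theorem exists_isExtension_degree {σ : Finset ι} (hσ : σ ∈ X.cones)
    (φ : X.sections k 𝒩 σ →ₗ[X.chartRing k σ] X.sections k ℳ σ) (d : X.Pic) :
    ∃ Φ : 𝒩 d →+ LocalizedModule (X.hatPowers k σ) M,
      ∀ (t : ℕ) (s : X.Cox k), s ∈ X.grading k (t • X.hatDeg σ - d) → ∀ (x : 𝒩 d)
        (h : s • (x : N) ∈ 𝒩 (t • X.hatDeg σ)),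
        s • Φ x = X.hat k σ ^ t • (φ (X.sectionMk k 𝒩 σ t (s • (x : N)) h)).1 := by
  obtain ⟨t, t', u, hu, v, hv, huv⟩ := X.exists_factor_hat_pow k hσ d
  have hux : ∀ x : 𝒩 d, u • (x : N) ∈ 𝒩 (t • X.hatDeg σ) := fun x =>
    X.smul_mem_of_mem hu x.2 (sub_add_cancel _ _)
  -- The formula is forced: `u` moves `x` into the degrees seen by `φ`, and since `u * v` is a power
  -- of `X.hat k σ`, multiplying by `v` over a power undoes `u`.
  let Φ : 𝒩 d →+ LocalizedModule (X.hatPowers k σ) M :=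
    { toFun := fun x => Localization.mk v (X.hatPow k σ t') •
        (φ (X.sectionMk k 𝒩 σ t (u • (x : N)) (hux x))).1
      map_zero' := by
        have : X.sectionMk k 𝒩 σ t (u • ((0 : 𝒩 d) : N)) (hux 0) = 0 := by
          refine Subtype.ext ?_
          change LocalizedModule.mk (u • (0 : N)) _ = 0
          rw [smul_zero, LocalizedModule.zero_mk]
        rw [this, map_zero]
        exact smul_zero _
      map_add' := fun x y => by
        have : X.sectionMk k 𝒩 σ t (u • ((x + y : 𝒩 d) : N)) (hux _) =
            X.sectionMk k 𝒩 σ t (u • (x : N)) (hux x) + X.sectionMk k 𝒩 σ t (u • (y : N)) (hux y) := by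
          refine Subtype.ext ?_
          change LocalizedModule.mk (u • ((x : N) + y)) _ =
            LocalizedModule.mk (u • (x : N)) _ + LocalizedModule.mk (u • (y : N)) _
          rw [LocalizedModule.mk_add_mk, ← smul_add, ← smul_add,
            LocalizedModule.mk_cancel_common_left]
        rw [this, map_add]
        exact smul_add _ _ _ }
  refine ⟨Φ, fun s a ha x h => ?_⟩
  have hΦ : X.hat k σ ^ t' • Φ x = v • (φ (X.sectionMk k 𝒩 σ t (u • (x : N)) (hux x))).1 := by
    change X.hat k σ ^ t' • (Localization.mk v (X.hatPow k σ t') •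
      (φ (X.sectionMk k 𝒩 σ t (u • (x : N)) (hux x))).1) = _
    generalize (φ (X.sectionMk k 𝒩 σ t (u • (x : N)) (hux x))).1 = z
    induction z using LocalizedModule.induction_on with
    | _ m w =>
      rw [LocalizedModule.mk_smul_mk, LocalizedModule.smul'_mk, LocalizedModule.smul'_mk]
      exact LocalizedModule.mk_cancel_common_left (X.hatPow k σ t') w (v • m)
  -- Comparing `a` with the chosen `u`: the degree of `a * v` is a multiple of `X.hatDeg σ`, so
  -- linearity of `φ` over the chart ring applies to it.
  have hav : a * v ∈ X.grading k ((s + t') • X.hatDeg σ) :=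
    X.mul_mem_of_mem ha hv (by rw [add_smul]; abel)
  have h3 : (a * v) • u • (x : N) ∈ 𝒩 ((s + t' + t) • X.hatDeg σ) :=
    X.smul_mem_of_mem hav (hux x) (by rw [← add_smul])
  have e1 := X.hat_pow_smul_map_sectionMk φ (hux x) hav h3 rfl rfl
  have e2 := X.hat_pow_smul_map_sectionMk φ h (X.hat_pow_mem (k := k) σ (t + t')) h3 (by ring)
    (by rw [← huv, smul_smul, smul_smul]; congr 1; ring)
  refine X.hat_pow_smul_injective σ (t + t') ?_
  beta_reduce
  rw [smul_comm _ (X.hat k σ ^ s), ← e2, smul_smul, pow_add _ t t', mul_assoc, mul_comm _ a,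
    mul_smul, mul_smul, hΦ, smul_smul a v, ← e1]
  have h4 : ∀ w : X.sections k ℳ σ, X.hat k σ ^ t • X.hat k σ ^ (s + t') • w.1 =
      X.hat k σ ^ s • (X.hat k σ ^ t * X.hat k σ ^ t') • w.1 := fun w => by
    rw [smul_smul, smul_smul]; congr 1; ring
  exact h4 _

end SmoothProjectiveFan

namespace SmoothProjectiveFan

variable {n : ℕ} {ι : Type*} [Fintype ι] [DecidableEq ι] (X : SmoothProjectiveFan n ι)
  {k : Type*} [Field k]
variable {M : Type*} [AddCommGroup M] [Module (X.Cox k) M]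
variable {ℳ : X.Pic → AddSubgroup M} [SetLike.GradedSMul (X.grading k) ℳ]
variable {N : Type*} [AddCommGroup N] [Module (X.Cox k) N]
variable {𝒩 : X.Pic → AddSubgroup N} [SetLike.GradedSMul (X.grading k) 𝒩]

theorem exists_isExtension [DirectSum.Decomposition 𝒩] {σ : Finset ι} (hσ : σ ∈ X.cones)
    (φ : X.sections k 𝒩 σ →ₗ[X.chartRing k σ] X.sections k ℳ σ) :
    ∃ Φ : N →ₗ[X.Cox k] LocalizedModule (X.hatPowers k σ) M, X.IsExtension φ Φ := by
  choose Φ hΦ using X.exists_isExtension_degree hσ φ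
  let Ψ : N →+ LocalizedModule (X.hatPowers k σ) M :=
    (DirectSum.toAddMonoid Φ).comp (DirectSum.decomposeAddEquiv 𝒩).toAddMonoidHom
  have hΨ : ∀ d (x : 𝒩 d), Ψ x = Φ d x := by
    intro d x
    change DirectSum.toAddMonoid Φ (DirectSum.decompose 𝒩 (x : N)) = _
    rw [DirectSum.decompose_coe, DirectSum.toAddMonoid_of]
  have hhom : ∀ (e d : X.Pic) (a : X.Cox k) (x : N), a ∈ X.grading k e → x ∈ 𝒩 d →
      Ψ (a • x) = a • Ψ x := by
    intro e d a x ha hx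
    obtain ⟨t, t', u, hu, v, hv, huv⟩ := X.exists_factor_hat_pow k hσ (e + d)
    have hax : a • x ∈ 𝒩 (e + d) := X.smul_mem_of_mem ha hx rfl
    have hua : u * a ∈ X.grading k (t • X.hatDeg σ - d) := X.mul_mem_of_mem hu ha (by abel)
    have huax : u • a • x ∈ 𝒩 (t • X.hatDeg σ) := X.smul_mem_of_mem hu hax (sub_add_cancel _ _)
    have h1 : u • Ψ (a • x) = _ := (congrArg _ (hΨ _ ⟨a • x, hax⟩)).trans
      (hΦ (e + d) t u hu ⟨a • x, hax⟩ huax)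
    have h2 : (u * a) • Ψ x = _ := (congrArg _ (hΨ _ ⟨x, hx⟩)).trans
      (hΦ d t (u * a) hua ⟨x, hx⟩ (by rwa [mul_smul]))
    have h3 : X.sectionMk k 𝒩 σ t (u • a • x) huax =
        X.sectionMk k 𝒩 σ t ((u * a) • x) (by rwa [mul_smul]) := by
      congr 1; rw [mul_smul]
    refine X.hat_pow_smul_injective σ (t + t') ?_
    beta_reduce
    rw [← huv, mul_comm u v, mul_smul, mul_smul, smul_smul u a, h1, h2]
    exact congrArg _ (congrArg _ (congrArg _ (congrArg _ h3)))
  refine ⟨{ Ψ with map_smul' := fun a x => ?_ }, fun d t s x hs hx h => ?_⟩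
  · change Ψ (a • x) = a • Ψ x
    induction a using DirectSum.Decomposition.inductionOn (X.grading k) with
    | zero => simp
    | add a b ha hb => rw [add_smul, map_add, ha, hb, add_smul]
    | homogeneous a =>
      induction x using DirectSum.Decomposition.inductionOn 𝒩 with
      | zero => simp
      | add x y hx hy => rw [smul_add, map_add, hx, hy, map_add, smul_add]
      | homogeneous x => exact hhom _ _ _ _ a.2 x.2
  · change s • Ψ x = _
    rw [hΨ d ⟨x, hx⟩]
    exact hΦ d t s hs ⟨x, hx⟩ h

/-! ### Kernels, images and exactness up to powers of `X.hat k σ` -/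

variable {X}

theorem IsExtension.apply_of_mem {σ : Finset ι}
    {φ : X.sections k 𝒩 σ →ₗ[X.chartRing k σ] X.sections k ℳ σ}
    {Φ : N →ₗ[X.Cox k] LocalizedModule (X.hatPowers k σ) M} (hΦ : X.IsExtension φ Φ)
    (t : ℕ) (x : N) (hx : x ∈ 𝒩 (t • X.hatDeg σ)) :
    Φ x = X.hat k σ ^ t • (φ (X.sectionMk k 𝒩 σ t x hx)).1 := by
  have h := hΦ (t • X.hatDeg σ) t 1 x
    (by rw [sub_self]; exact SetLike.one_mem_graded (X.grading k)) hx (by rwa [one_smul])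
  rw [one_smul] at h
  rw [h]
  simp only [one_smul]

theorem IsExtension.exists_hat_pow_smul_eq {σ : Finset ι} (hσ : σ ∈ X.cones)
    {φ : X.sections k 𝒩 σ →ₗ[X.chartRing k σ] X.sections k ℳ σ}
    {Φ : N →ₗ[X.Cox k] LocalizedModule (X.hatPowers k σ) M} (hΦ : X.IsExtension φ Φ)
    (d : X.Pic) (x : N) (hx : x ∈ 𝒩 d) :
    ∃ t, ∃ m ∈ ℳ (t • X.hatDeg σ + d), X.hat k σ ^ t • Φ x = LocalizedModule.mk m 1 := by
  obtain ⟨t, t', u, hu, v, hv, huv⟩ := X.exists_factor_hat_pow k hσ d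
  have hux : u • x ∈ 𝒩 (t • X.hatDeg σ) := X.smul_mem_of_mem hu hx (sub_add_cancel _ _)
  have h1 := hΦ d t u x hu hx hux
  obtain ⟨s, m, hm, hφ⟩ := X.exists_eq_sectionMk (φ (X.sectionMk k 𝒩 σ t (u • x) hux))
  rw [hφ] at h1
  refine ⟨s + t + t', v • X.hat k σ ^ t • m, ?_, ?_⟩
  · exact X.smul_mem_of_mem hv (X.smul_mem_of_mem (X.hat_pow_mem σ t) hm rfl)
      (by rw [add_smul, add_smul]; abel)
  · have h2 : X.hat k σ ^ s • (X.sectionMk k ℳ σ s m hm).1 = LocalizedModule.mk m 1 :=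
      X.hat_pow_smul_mk σ s m
    rw [add_assoc, pow_add, ← huv, mul_comm u v, mul_smul, mul_smul, h1,
      ← LocalizedModule.smul'_mk, ← LocalizedModule.smul'_mk, ← h2,
      smul_comm (X.hat k σ ^ s) v, smul_comm (X.hat k σ ^ s) (X.hat k σ ^ t)]

/-- The kernel of `Φ` is homogeneous because `Φ` preserves degrees. No grading on the localization
is used: the components are brought to a common denominator and compared in `M`, where numerators of
different components have different degrees. -/
theorem IsExtension.apply_decompose_eq_zero [DirectSum.Decomposition 𝒩]
    [DirectSum.Decomposition ℳ] {σ : Finset ι} (hσ : σ ∈ X.cones)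
    {φ : X.sections k 𝒩 σ →ₗ[X.chartRing k σ] X.sections k ℳ σ}
    {Φ : N →ₗ[X.Cox k] LocalizedModule (X.hatPowers k σ) M} (hΦ : X.IsExtension φ Φ)
    {x : N} (hx : Φ x = 0) (d : X.Pic) : Φ (DirectSum.decompose 𝒩 x d) = 0 := by
  classical
  choose t m hm htm using fun e =>
    hΦ.exists_hat_pow_smul_eq hσ e (DirectSum.decompose 𝒩 x e) (DirectSum.decompose 𝒩 x e).2
  set s := (DirectSum.decompose 𝒩 x).support with hs
  by_cases hd : d ∈ s
  swap
  · have : DirectSum.decompose 𝒩 x d = 0 := DFinsupp.notMem_support_iff.1 hd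
    rw [this, ZeroMemClass.coe_zero, map_zero]
  set T := s.sup t with hT
  let y : X.Pic → M := fun e => X.hat k σ ^ (T - t e) • m e
  have hy : ∀ e ∈ s, y e ∈ ℳ (T • X.hatDeg σ + e) := fun e he => by
    refine X.smul_mem_of_mem (X.hat_pow_mem σ _) (hm e) ?_
    rw [← add_assoc, ← add_smul, Nat.sub_add_cancel (Finset.le_sup he)]
  have hyΦ : ∀ e ∈ s, X.hat k σ ^ T • Φ (DirectSum.decompose 𝒩 x e) =
      LocalizedModule.mk (y e) 1 := fun e he => by
    rw [← LocalizedModule.smul'_mk, ← htm, smul_smul, ← pow_add,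
      Nat.sub_add_cancel (Finset.le_sup he)]
  have hsum : (LocalizedModule.mk (∑ e ∈ s, y e) 1 : LocalizedModule (X.hatPowers k σ) M) = 0 := by
    have h1 : (LocalizedModule.mk (∑ e ∈ s, y e) 1 : LocalizedModule (X.hatPowers k σ) M) =
        ∑ e ∈ s, LocalizedModule.mk (y e) 1 :=
      map_sum (LocalizedModule.mkLinearMap (X.hatPowers k σ) M) y s
    rw [h1, ← Finset.sum_congr rfl hyΦ, ← Finset.smul_sum, ← map_sum, hs,
      DirectSum.sum_support_decompose 𝒩 x, hx, smul_zero]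
  obtain ⟨j, hj⟩ := X.mk_one_eq_zero_iff.1 hsum
  have hjd : X.hat k σ ^ j • y d = 0 := by
    have hmem : ∀ e ∈ s, X.hat k σ ^ j • y e ∈ ℳ (j • X.hatDeg σ + (T • X.hatDeg σ + e)) :=
      fun e he => X.smul_mem_of_mem (X.hat_pow_mem σ j) (hy e he) rfl
    have h2 : ((DirectSum.decompose ℳ (X.hat k σ ^ j • ∑ e ∈ s, y e))
        (j • X.hatDeg σ + (T • X.hatDeg σ + d)) : M) = X.hat k σ ^ j • y d := by
      rw [Finset.smul_sum, DirectSum.decompose_sum, DFinsupp.finsetSum_apply,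
        AddSubgroup.val_finsetSum, Finset.sum_eq_single d]
      · exact DirectSum.decompose_of_mem_same _ (hmem d hd)
      · intro e he hed
        exact DirectSum.decompose_of_mem_ne _ (hmem e he) (by simpa using hed)
      · exact fun h => absurd hd h
    rw [← h2, hj, DirectSum.decompose_zero]
    rfl
  refine X.hat_pow_smul_injective σ T ?_
  beta_reduce
  rw [hyΦ d hd, smul_zero]
  exact X.mk_one_eq_zero_iff.2 ⟨j, hjd⟩

theorem exists_hat_pow_smul_mem_sum {σ : Finset ι} (W : Submodule (X.Cox k) N) {α : Type*}
    (s : Finset α) (f : α → N) (hf : ∀ i ∈ s, ∃ j, X.hat k σ ^ j • f i ∈ W) :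
    ∃ j, X.hat k σ ^ j • ∑ i ∈ s, f i ∈ W := by
  refine Finset.sum_induction f (fun x => ∃ j, X.hat k σ ^ j • x ∈ W) ?_ ⟨0, by simp⟩ hf
  rintro a b ⟨i, hi⟩ ⟨j, hj⟩
  refine ⟨i + j, ?_⟩
  rw [smul_add]
  refine add_mem ?_ ?_
  · rw [add_comm, pow_add, mul_smul]; exact W.smul_mem _ hi
  · rw [pow_add, mul_smul]; exact W.smul_mem _ hj

/-- Exactness on sections implies exactness in all degrees up to powers of `X.hat k σ`. -/
theorem IsExtension.exists_hat_pow_smul_mem_range [DirectSum.Decomposition 𝒩]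
    [DirectSum.Decomposition ℳ] {σ : Finset ι} (hσ : σ ∈ X.cones)
    {φ : X.sections k 𝒩 σ →ₗ[X.chartRing k σ] X.sections k ℳ σ}
    {Φ : N →ₗ[X.Cox k] LocalizedModule (X.hatPowers k σ) M} (hΦ : X.IsExtension φ Φ)
    {L : Type*} [AddCommGroup L] [Module (X.Cox k) L]
    {ℒ : X.Pic → AddSubgroup L} [SetLike.GradedSMul (X.grading k) ℒ]
    (f : L →ₗ[X.Cox k] N) (hf : ∀ d, ∀ m ∈ ℒ d, f m ∈ 𝒩 d)
    (hex : Function.Exact (X.sectionsMap f hf σ) φ) {x : N} (hx : Φ x = 0) :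
    ∃ j, X.hat k σ ^ j • x ∈ LinearMap.range f := by
  classical
  rw [← DirectSum.sum_support_decompose 𝒩 x]
  refine exists_hat_pow_smul_mem_sum _ _ _ fun d _ => ?_
  have hxd := hΦ.apply_decompose_eq_zero hσ hx d
  obtain ⟨t, t', u, hu, v, hv, huv⟩ := X.exists_factor_hat_pow k hσ d
  set z : 𝒩 d := DirectSum.decompose 𝒩 x d
  have huz : u • (z : N) ∈ 𝒩 (t • X.hatDeg σ) := X.smul_mem_of_mem hu z.2 (sub_add_cancel _ _)
  have h1 := hΦ d t u z hu z.2 huz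
  rw [hxd, smul_zero] at h1
  have h2 : φ (X.sectionMk k 𝒩 σ t (u • (z : N)) huz) = 0 :=
    Subtype.ext (X.hat_pow_smul_injective σ t (by
      beta_reduce
      rw [← h1]
      exact (smul_zero _).symm))
  obtain ⟨w, hw⟩ := (hex _).1 h2
  obtain ⟨s, y, hy, rfl⟩ := X.exists_eq_sectionMk w
  have h3 : (LocalizedModule.mk (f y) (X.hatPow k σ s) : LocalizedModule (X.hatPowers k σ) N) =
      LocalizedModule.mk (u • (z : N)) (X.hatPow k σ t) :=
    (LocalizedModule.map_mk (X.hatPowers k σ) f y _).symm.trans (congrArg Subtype.val hw)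
  rw [LocalizedModule.mk_eq] at h3
  obtain ⟨⟨_, i, rfl⟩, hi⟩ := h3
  have hi' : X.hat k σ ^ i • X.hat k σ ^ t • f y = X.hat k σ ^ i • X.hat k σ ^ s • u • (z : N) := hi
  -- The factor `v` cancels the `u` that moved the component into chart degrees.
  refine ⟨i + s + (t + t'), v • X.hat k σ ^ i • X.hat k σ ^ t • y, ?_⟩
  rw [map_smul, map_smul, map_smul, hi', pow_add, pow_add, ← huv]
  simp only [smul_smul]
  congr 1; ring

/-- Surjectivity on sections implies surjectivity in all degrees up to powers of `X.hat k σ`. -/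
theorem IsExtension.exists_apply_eq_hat_pow_smul [DirectSum.Decomposition ℳ] {σ : Finset ι}
    (hσ : σ ∈ X.cones) {φ : X.sections k 𝒩 σ →ₗ[X.chartRing k σ] X.sections k ℳ σ}
    {Φ : N →ₗ[X.Cox k] LocalizedModule (X.hatPowers k σ) M} (hΦ : X.IsExtension φ Φ)
    (hsurj : Function.Surjective φ) (m : M) :
    ∃ x j, Φ x = X.hat k σ ^ j • LocalizedModule.mk m 1 := by
  suffices h : ∃ j, X.hat k σ ^ j • m ∈ (LinearMap.range Φ).comap
      (LocalizedModule.mkLinearMap (X.hatPowers k σ) M) by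
    obtain ⟨j, x, hx⟩ := h
    exact ⟨x, j, hx.trans (map_smul _ _ _)⟩
  classical
  rw [← DirectSum.sum_support_decompose ℳ m]
  refine exists_hat_pow_smul_mem_sum _ _ _ fun d _ => ?_
  obtain ⟨t, t', u, hu, v, hv, huv⟩ := X.exists_factor_hat_pow k hσ d
  set z : ℳ d := DirectSum.decompose ℳ m d
  have huz : u • (z : M) ∈ ℳ (t • X.hatDeg σ) := X.smul_mem_of_mem hu z.2 (sub_add_cancel _ _)
  obtain ⟨w, hw⟩ := hsurj (X.sectionMk k ℳ σ t (u • (z : M)) huz)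
  obtain ⟨s, y, hy, rfl⟩ := X.exists_eq_sectionMk w
  have h1 := hΦ.apply_of_mem s y hy
  have h2 : X.hat k σ ^ t • (X.sectionMk k ℳ σ t (u • (z : M)) huz).1 =
      LocalizedModule.mk (u • (z : M)) 1 := X.hat_pow_smul_mk σ t _
  rw [hw] at h1
  refine ⟨s + (t + t'), v • X.hat k σ ^ t • y, ?_⟩
  rw [map_smul, map_smul, h1, smul_comm (X.hat k σ ^ t), h2, pow_add, ← huv,
    LocalizedModule.mkLinearMap_apply, LocalizedModule.smul'_mk, LocalizedModule.smul'_mk]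
  simp only [smul_smul]
  congr 2; ring

theorem IsExtension.apply_map_eq_zero {σ : Finset ι} (hσ : σ ∈ X.cones)
    {φ : X.sections k 𝒩 σ →ₗ[X.chartRing k σ] X.sections k ℳ σ}
    {Φ : N →ₗ[X.Cox k] LocalizedModule (X.hatPowers k σ) M} (hΦ : X.IsExtension φ Φ)
    {L : Type*} [AddCommGroup L] [Module (X.Cox k) L]
    {ℒ : X.Pic → AddSubgroup L} [SetLike.GradedSMul (X.grading k) ℒ] [DirectSum.Decomposition ℒ]
    (f : L →ₗ[X.Cox k] N) (hf : ∀ d, ∀ m ∈ ℒ d, f m ∈ 𝒩 d)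
    (hex : Function.Exact (X.sectionsMap f hf σ) φ) (y : L) : Φ (f y) = 0 := by
  induction y using DirectSum.Decomposition.inductionOn ℒ with
  | zero => simp
  | add x y hx hy => rw [map_add, map_add, hx, hy, add_zero]
  | @homogeneous d y =>
    obtain ⟨t, t', u, hu, v, hv, huv⟩ := X.exists_factor_hat_pow k hσ d
    have huy : u • (y : L) ∈ ℒ (t • X.hatDeg σ) := X.smul_mem_of_mem hu y.2 (sub_add_cancel _ _)
    have huf : u • f (y : L) ∈ 𝒩 (t • X.hatDeg σ) := by
      rw [← map_smul]; exact hf _ _ huy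
    have h1 := hΦ d t u (f y) hu (hf _ _ y.2) huf
    have h2 : X.sectionMk k 𝒩 σ t (u • f (y : L)) huf =
        X.sectionsMap f hf σ (X.sectionMk k ℒ σ t (u • (y : L)) huy) := by
      refine Subtype.ext (.symm ((LocalizedModule.map_mk (X.hatPowers k σ) f _ _).trans ?_))
      rw [map_smul]; rfl
    have h3 : φ (X.sectionMk k 𝒩 σ t (u • f (y : L)) huf) = 0 := by
      rw [h2]; exact hex.apply_apply_eq_zero _
    rw [h3] at h1
    refine X.hat_pow_smul_injective σ (t + t') ?_
    beta_reduce
    rw [← huv, mul_comm, mul_smul, h1, smul_zero]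
    change v • X.hat k σ ^ t • (0 : LocalizedModule (X.hatPowers k σ) M) = 0
    rw [smul_zero, smul_zero]

theorem IsExtension.exists_hat_pow_smul_eq_zero [DirectSum.Decomposition 𝒩]
    [DirectSum.Decomposition ℳ] {σ : Finset ι} (hσ : σ ∈ X.cones)
    {φ : X.sections k 𝒩 σ →ₗ[X.chartRing k σ] X.sections k ℳ σ}
    {Φ : N →ₗ[X.Cox k] LocalizedModule (X.hatPowers k σ) M} (hΦ : X.IsExtension φ Φ)
    (hinj : Function.Injective φ) {x : N} (hx : Φ x = 0) : ∃ j, X.hat k σ ^ j • x = 0 := by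
  have h0 : ∀ z, X.sectionsMap (ℳ := 𝒩) (𝒩 := 𝒩) (0 : N →ₗ[X.Cox k] N) (fun _ _ _ => zero_mem _) σ z = 0 := by
    intro z
    obtain ⟨t, m, hm, rfl⟩ := X.exists_eq_sectionMk z
    refine Subtype.ext ((LocalizedModule.map_mk (X.hatPowers k σ) 0 _ _).trans ?_)
    exact LocalizedModule.zero_mk _
  -- Injectivity of `φ` is exactness after the zero map, and the range of the zero map is zero.
  obtain ⟨j, y, hy⟩ := hΦ.exists_hat_pow_smul_mem_range hσ (ℒ := 𝒩) 0 (fun _ _ _ => zero_mem _)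
    (fun z => ⟨fun hz => ⟨0, (h0 0).trans (hinj (hz.trans (map_zero φ).symm)).symm⟩, by
      rintro ⟨w, rfl⟩
      rw [h0, map_zero]⟩) hx
  exact ⟨j, hy.symm⟩

theorem isExtension_sectionsMap {σ : Finset ι} (f : N →ₗ[X.Cox k] M)
    (hf : ∀ d, ∀ m ∈ 𝒩 d, f m ∈ ℳ d) :
    X.IsExtension (X.sectionsMap f hf σ)
      (LocalizedModule.mkLinearMap (X.hatPowers k σ) M ∘ₗ f) := by
  intro d t s x _ _ h
  have h1 : (X.sectionsMap f hf σ (X.sectionMk k 𝒩 σ t (s • x) h)).1 =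
      LocalizedModule.mk (f (s • x)) (X.hatPow k σ t) :=
    LocalizedModule.map_mk (X.hatPowers k σ) f _ _
  rw [h1, X.hat_pow_smul_mk, map_smul, ← LocalizedModule.smul'_mk]
  rfl

end SmoothProjectiveFan

/-! ### Homogeneous decomposition of graded free modules -/

namespace SmoothProjectiveFan

variable {n : ℕ} {ι : Type*} [Fintype ι] [DecidableEq ι] (X : SmoothProjectiveFan n ι)
  (k : Type*) [Field k]

/-- The inclusion of the `j`-th summand of a graded free module, in a given degree. -/
noncomputable def freeGradingSingle {r : ℕ} (a : Fin r → X.Pic) (j : Fin r) (e : X.Pic) :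
    X.grading k e →+ X.freeGrading k a (e + a j) where
  toFun s := ⟨Pi.single j (s : X.Cox k), fun l => by
    rcases eq_or_ne l j with rfl | h
    · rw [Pi.single_eq_same, add_sub_cancel_right]; exact s.2
    · rw [Pi.single_eq_of_ne h]; exact zero_mem _⟩
  map_zero' := Subtype.ext (by simp)
  map_add' s t := Subtype.ext (by simp [Pi.single_add])

/-- The decomposition of a graded free module into homogeneous components. -/
noncomputable def freeGradingDecompose {r : ℕ} (a : Fin r → X.Pic) :
    (Fin r → X.Cox k) →+ DirectSum X.Pic fun d => X.freeGrading k a d :=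
  ∑ j, ((DirectSum.toAddMonoid fun e => (DirectSum.of (fun d => X.freeGrading k a d) (e + a j)).comp
    (X.freeGradingSingle k a j e)).comp
      (DirectSum.decomposeAddEquiv (X.grading k)).toAddMonoidHom).comp (Pi.evalAddMonoidHom _ j)

noncomputable instance {r : ℕ} (a : Fin r → X.Pic) :
    DirectSum.Decomposition (X.freeGrading k a) :=
  DirectSum.Decomposition.ofAddHom (X.freeGrading k a) (X.freeGradingDecompose k a)
    (by
      have hj : ∀ j (s : X.Cox k), DirectSum.coeAddMonoidHom (X.freeGrading k a)
          (DirectSum.toAddMonoid (fun e => (DirectSum.of (fun d => X.freeGrading k a d)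
            (e + a j)).comp (X.freeGradingSingle k a j e))
            (DirectSum.decompose (X.grading k) s)) = Pi.single j s := by
        intro j s
        induction s using DirectSum.Decomposition.inductionOn (X.grading k) with
        | zero => simp
        | add s t hs ht =>
          rw [DirectSum.decompose_add, map_add, map_add, hs, ht, Pi.single_add]
        | homogeneous s =>
          rw [DirectSum.decompose_coe, DirectSum.toAddMonoid_of, AddMonoidHom.comp_apply,
            DirectSum.coeAddMonoidHom_of]
          rfl
      refine AddMonoidHom.ext fun f => ?_
      simp only [freeGradingDecompose, AddMonoidHom.comp_apply, AddMonoidHom.finsetSum_apply,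
        map_sum, AddMonoidHom.id_apply]
      exact (Finset.sum_congr rfl fun j _ => hj j (f j)).trans (Finset.univ_sum_single f))
    (by
      refine DirectSum.addHom_ext fun d x => ?_
      have hx : ∀ j, x.1 j ∈ X.grading k (d - a j) := x.2
      have hof : ∀ (e d : X.Pic) (h : e = d) (y : X.freeGrading k a e),
          DirectSum.of (fun d => X.freeGrading k a d) e y =
            DirectSum.of (fun d => X.freeGrading k a d) d ⟨y.1, h ▸ y.2⟩ := by
        rintro e _ rfl y; rfl
      have hmem : ∀ j, (Pi.single j (x.1 j) : Fin r → X.Cox k) ∈ X.freeGrading k a d := by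
        intro j l
        rcases eq_or_ne l j with rfl | h
        · rw [Pi.single_eq_same]; exact hx l
        · rw [Pi.single_eq_of_ne h]; exact zero_mem _
      have hj : ∀ j, DirectSum.toAddMonoid (fun e => (DirectSum.of (fun d => X.freeGrading k a d)
            (e + a j)).comp (X.freeGradingSingle k a j e))
            (DirectSum.decompose (X.grading k) (x.1 j)) =
          DirectSum.of (fun d => X.freeGrading k a d) d ⟨Pi.single j (x.1 j), hmem j⟩ := by
        intro j
        rw [DirectSum.decompose_of_mem _ (hx j), DirectSum.toAddMonoid_of, AddMonoidHom.comp_apply,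
          hof _ d (sub_add_cancel _ _)]
        rfl
      rw [AddMonoidHom.comp_apply, DirectSum.coeAddMonoidHom_of, AddMonoidHom.id_apply]
      simp only [freeGradingDecompose, AddMonoidHom.finsetSum_apply, AddMonoidHom.comp_apply]
      refine (Finset.sum_congr rfl fun j _ => hj j).trans ?_
      rw [← map_sum]
      congr 1
      refine Subtype.ext ?_
      rw [AddSubgroup.val_finsetSum]
      exact Finset.univ_sum_single x.1)

end SmoothProjectiveFan

/-! ### Associated primes, annihilators and saturation -/

theorem mem_associatedPrimes_iff_exists {R M : Type*} [CommRing R] [IsNoetherianRing R]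
    [AddCommGroup M] [Module R M] {P : Ideal R} :
    P ∈ associatedPrimes R M ↔ P.IsPrime ∧ ∃ m : M, ∀ a, a ∈ P ↔ a • m = 0 := by
  rw [AssociatedPrimes.mem_iff, isAssociatedPrime_iff]
  simp only [SetLike.ext_iff, Submodule.mem_colon_singleton, Submodule.mem_bot]

theorem LinearMap.exists_pow_smul_eq_zero {R L M : Type*} [CommRing R] [AddCommGroup L] [Module R L]
    [Module.Finite R L] [AddCommGroup M] [Module R M] (g : L →ₗ[R] M) (h : R)
    (hg : ∀ x, ∃ j : ℕ, h ^ j • g x = 0) : ∃ j : ℕ, ∀ x, h ^ j • g x = 0 := by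
  obtain ⟨s, hs⟩ := Module.Finite.fg_top (R := R) (M := L)
  choose j hj using hg
  have hle : Submodule.span R (s : Set L) ≤ LinearMap.ker (h ^ s.sup j • g) := by
    rw [Submodule.span_le]
    intro x hx
    change h ^ s.sup j • g x = 0
    rw [← Nat.sub_add_cancel (Finset.le_sup (f := j) hx), pow_add, mul_smul, hj, smul_zero]
  exact ⟨s.sup j, fun x => hle (hs ▸ Submodule.mem_top)⟩

namespace SmoothProjectiveFan

variable {n : ℕ} {ι : Type*} [Fintype ι] [DecidableEq ι] {X : SmoothProjectiveFan n ι}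
  {k : Type*} [Field k]
variable {M : Type*} [AddCommGroup M] [Module (X.Cox k) M]
variable {ℳ : X.Pic → AddSubgroup M} [SetLike.GradedSMul (X.grading k) ℳ]
variable {N : Type*} [AddCommGroup N] [Module (X.Cox k) N]
variable {𝒩 : X.Pic → AddSubgroup N} [SetLike.GradedSMul (X.grading k) 𝒩]

theorem height_eq_of_mem_associatedPrimes [DirectSum.Decomposition ℳ]
    (hM : X.vdim k ℳ = (Module.annihilator (X.Cox k) M).height) {P : Ideal (X.Cox k)}
    (hP : P ∈ associatedPrimes (X.Cox k) M) {σ : Finset ι} (hσ : σ ∈ X.cones)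
    (hσP : X.hat k σ ∉ P) : P.height = (Module.annihilator (X.Cox k) M).height := by
  have hann : Module.annihilator (X.Cox k) M ≤ P :=
    Submodule.annihilator_top (R := X.Cox k) (M := M) ▸ hP.annihilator_le
  obtain ⟨hPp, m, hm⟩ := mem_associatedPrimes_iff_exists.1 hP
  have hhat : ∀ j, X.hat k σ ^ j ∉ P := fun j h => hσP (hPp.mem_of_pow_mem j h)
  refine le_antisymm ?_ (Ideal.height_mono hann)
  by_contra! hlt
  obtain ⟨h, hh⟩ := ENat.ne_top_iff_exists.1 (Ideal.height_ne_top_of_isPrime (I := P))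
  rw [← hh, ← hM, vdim] at hlt
  simp only [iInf_lt_iff] at hlt
  obtain ⟨F, ⟨ε, hε⟩, hlen⟩ := hlt
  obtain ⟨Φ, hΦ⟩ := X.exists_isExtension hσ (ε.app σ hσ)
  obtain ⟨hsurj, hex0, hex⟩ := hε σ hσ
  obtain ⟨x, j, hx⟩ := hΦ.exists_apply_eq_hat_pow_smul hσ hsurj m
  have hax : ∀ a : X.Cox k, Φ (a • x) =
      (LocalizedModule.mk ((a * X.hat k σ ^ j) • m) 1 : LocalizedModule (X.hatPowers k σ) M) := by
    intro a
    rw [map_smul, hx, LocalizedModule.smul'_mk, LocalizedModule.smul'_mk, smul_smul]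
  -- Powers of `X.hat k σ` lie outside `P`, so exactness up to such powers suffices. The lift `x` of
  -- a multiple of `m` is the depth-zero witness: locally at `P`, its class modulo the image of `F.d
  -- 0` is nonzero and killed by `P`.
  have hrank := IsRegularRing.rank_height_ne_zero P h hh.symm F.rank F.d F.d_comp_d
    (fun i f hf => by
      obtain ⟨t, ht⟩ := (isExtension_sectionsMap (F.d i) (F.d_mem i)).exists_hat_pow_smul_mem_range
        hσ (F.d (i + 1)) (F.d_mem (i + 1)) (hex i) (x := f) (by
          rw [LinearMap.comp_apply, hf, map_zero])
      exact ⟨_, hhat t, ht⟩) x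
    (fun a ha => by
      obtain ⟨t, ht⟩ := hΦ.exists_hat_pow_smul_mem_range hσ (F.d 0) (F.d_mem 0) hex0
        (x := a • x) (by
          rw [hax, mul_comm, mul_smul, (hm a).1 ha, smul_zero, LocalizedModule.zero_mk])
      exact ⟨_, hhat t, ht⟩)
    (fun s hs hsx => by
      obtain ⟨y, hy⟩ := hsx
      have h1 := hΦ.apply_map_eq_zero hσ (F.d 0) (F.d_mem 0) hex0 y
      rw [hy, hax, mk_one_eq_zero_iff] at h1
      obtain ⟨i, hi⟩ := h1
      rw [smul_smul, ← hm] at hi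
      exact ((hPp.mem_or_mem hi).resolve_left (hhat i) |> hPp.mem_or_mem).elim hs (hhat j))
  exact absurd hlen (not_lt.2 (le_iSup₂ (f := fun (i : ℕ) (_ : F.rank i ≠ 0) => (i : ℕ∞)) h hrank))

/-- If `P` is the annihilator of `x`, a numerator `m` of `Φ x` has the same annihilator up to powers
of `X.hat k σ`. Since `P` is finitely generated, one power, multiplied into `m`, makes the
annihilator exactly `P`. -/
theorem mem_associatedPrimes_of_sheafIso [DirectSum.Decomposition ℳ] [DirectSum.Decomposition 𝒩]
    {P : Ideal (X.Cox k)} (hP : P ∈ associatedPrimes (X.Cox k) N) {σ : Finset ι}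
    (hσ : σ ∈ X.cones) (hσP : X.hat k σ ∉ P) (hiso : X.SheafIso k 𝒩 ℳ) :
    P ∈ associatedPrimes (X.Cox k) M := by
  obtain ⟨ψ, hψ⟩ := hiso
  obtain ⟨Φ, hΦ⟩ := X.exists_isExtension hσ (ψ.app σ hσ)
  obtain ⟨hPp, x, hx⟩ := mem_associatedPrimes_iff_exists.1 hP
  have hhat : ∀ j, X.hat k σ ^ j ∉ P := fun j h => hσP (hPp.mem_of_pow_mem j h)
  obtain ⟨j, m, hm⟩ := X.exists_hat_pow_smul_eq_mk (Φ x)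
  have hax : ∀ a : X.Cox k, (LocalizedModule.mk (a • m) 1 : LocalizedModule (X.hatPowers k σ) M) =
      X.hat k σ ^ j • Φ (a • x) := by
    intro a
    rw [← LocalizedModule.smul'_mk, ← hm, map_smul, smul_comm]
  obtain ⟨i, hi⟩ := LinearMap.exists_pow_smul_eq_zero
    (LinearMap.toSpanSingleton (X.Cox k) M m ∘ₗ P.subtype) (X.hat k σ) (fun a => by
      refine X.mk_one_eq_zero_iff.1 ?_
      refine (hax a).trans ?_
      rw [(hx a).1 a.2, map_zero, smul_zero])
  refine mem_associatedPrimes_iff_exists.2 ⟨hPp, X.hat k σ ^ i • m, fun a => ⟨fun ha => ?_, fun ha => ?_⟩⟩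
  · rw [smul_comm]; exact hi ⟨a, ha⟩
  · have h1 : X.hat k σ ^ (i + j) • Φ (a • x) = 0 := by
      rw [pow_add, mul_smul, ← hax, LocalizedModule.smul'_mk, smul_comm, ha,
        LocalizedModule.zero_mk]
    rw [← map_smul] at h1
    obtain ⟨l, hl⟩ := hΦ.exists_hat_pow_smul_eq_zero hσ (hψ σ hσ).1 h1
    rw [smul_smul, smul_smul, ← hx, ← pow_add] at hl
    exact (hPp.mem_or_mem hl).resolve_left (hhat _)

theorem exists_irrelevant_pow_le {I : Ideal (X.Cox k)}
    (h : ∀ σ ∈ X.cones, ∃ t : ℕ, X.hat k σ ^ t ∈ I) : ∃ t, X.irrelevant k ^ t ≤ I := by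
  refine Ideal.exists_pow_le_of_le_radical_of_fg ?_ (IsNoetherian.noetherian _)
  rw [irrelevant, Ideal.span_le]
  rintro _ ⟨σ, hσ, rfl⟩
  exact h σ hσ

theorem hat_mem_irrelevant {σ : Finset ι} (hσ : σ ∈ X.cones) : X.hat k σ ∈ X.irrelevant k :=
  Ideal.subset_span ⟨σ, hσ, rfl⟩

theorem exists_hat_notMem {P : Ideal (X.Cox k)} (hP : ¬ X.irrelevant k ≤ P) :
    ∃ σ ∈ X.cones, X.hat k σ ∉ P := by
  by_contra! h
  refine hP (Ideal.span_le.2 ?_)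
  rintro _ ⟨σ, hσ, rfl⟩
  exact h σ hσ

theorem IsSaturated.exists_hat_notMem (hN : X.IsSaturated k N) {P : Ideal (X.Cox k)}
    (hP : P ∈ associatedPrimes (X.Cox k) N) : ∃ σ ∈ X.cones, X.hat k σ ∉ P := by
  obtain ⟨hPp, x, hx⟩ := mem_associatedPrimes_iff_exists.1 hP
  refine SmoothProjectiveFan.exists_hat_notMem fun h => hPp.ne_top ((Ideal.eq_top_iff_one _).2 ?_)
  rw [hx, one_smul]
  exact hN x ⟨1, fun b hb => (hx b).1 (h (pow_one (X.irrelevant k) ▸ hb))⟩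

theorem mem_saturation_iff {I : Ideal (X.Cox k)} {s : X.Cox k} :
    s ∈ X.saturation k I ↔ ∀ σ ∈ X.cones, ∃ t : ℕ, X.hat k σ ^ t * s ∈ I := by
  rw [saturation, Submodule.mem_iSup_of_directed]
  · constructor
    · rintro ⟨t, ht⟩ σ hσ
      refine ⟨t, ?_⟩
      rw [mul_comm]
      exact Submodule.mem_colon.1 ht _ (Ideal.pow_mem_pow (hat_mem_irrelevant hσ) t)
    · intro h
      obtain ⟨t, ht⟩ := exists_irrelevant_pow_le (I := Submodule.colon I {s}) (fun σ hσ => by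
        obtain ⟨t, ht⟩ := h σ hσ
        exact ⟨t, Submodule.mem_colon_singleton.2 ht⟩)
      refine ⟨t, Submodule.mem_colon.2 fun b hb => ?_⟩
      rw [smul_eq_mul, mul_comm]
      exact Submodule.mem_colon_singleton.1 (ht hb)
  · refine Monotone.directed_le fun i j hij s hs => Submodule.mem_colon.2 fun b hb => ?_
    exact Submodule.mem_colon.1 hs b (Ideal.pow_le_pow_right hij hb)

/-- On each chart the two modules agree up to powers of `X.hat k σ`. Finite generation of `M` makes
the exponent uniform in one direction; saturation of `N` removes the powers in the other, so `N` may
be infinitely generated. -/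
theorem annihilator_eq_saturation [Module.Finite (X.Cox k) M] [DirectSum.Decomposition ℳ]
    [DirectSum.Decomposition 𝒩] (hN : X.IsSaturated k N) (hiso : X.SheafIso k 𝒩 ℳ) :
    Module.annihilator (X.Cox k) N = X.saturation k (Module.annihilator (X.Cox k) M) := by
  obtain ⟨ψ, hψ⟩ := hiso
  ext s
  rw [mem_saturation_iff, Module.mem_annihilator]
  constructor
  · intro hs σ hσ
    obtain ⟨Φ, hΦ⟩ := X.exists_isExtension hσ (ψ.app σ hσ)
    obtain ⟨t, ht⟩ := LinearMap.exists_pow_smul_eq_zero (LinearMap.lsmul (X.Cox k) M s)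
      (X.hat k σ) fun m => by
        obtain ⟨x, j, hx⟩ := hΦ.exists_apply_eq_hat_pow_smul hσ (hψ σ hσ).2 m
        have h1 : (LocalizedModule.mk ((s * X.hat k σ ^ j) • m) 1 :
            LocalizedModule (X.hatPowers k σ) M) = 0 := by
          rw [mul_smul, ← LocalizedModule.smul'_mk, ← LocalizedModule.smul'_mk, ← hx, ← map_smul,
            hs, map_zero]
        obtain ⟨i, hi⟩ := X.mk_one_eq_zero_iff.1 h1
        refine ⟨i + j, ?_⟩
        rw [mul_smul, smul_comm s] at hi
        rw [pow_add, mul_smul]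
        exact hi
    refine ⟨t, Module.mem_annihilator.2 fun m => ?_⟩
    rw [mul_smul]
    exact ht m
  · intro hs x
    have hx : ∀ σ ∈ X.cones, ∃ t : ℕ, X.hat k σ ^ t ∈
        LinearMap.ker (LinearMap.toSpanSingleton (X.Cox k) N (s • x)) := by
      intro σ hσ
      obtain ⟨Φ, hΦ⟩ := X.exists_isExtension hσ (ψ.app σ hσ)
      obtain ⟨t, ht⟩ := hs σ hσ
      have h1 : Φ (X.hat k σ ^ t • s • x) = 0 := by
        rw [smul_smul, map_smul]
        generalize Φ x = z
        induction z using LocalizedModule.induction_on with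
        | _ m w =>
          rw [LocalizedModule.smul'_mk, Module.mem_annihilator.1 ht, LocalizedModule.zero_mk]
      obtain ⟨j, hj⟩ := hΦ.exists_hat_pow_smul_eq_zero hσ (hψ σ hσ).1 h1
      refine ⟨j + t, ?_⟩
      rw [LinearMap.mem_ker, LinearMap.toSpanSingleton_apply, pow_add, mul_smul]
      exact hj
    obtain ⟨t, ht⟩ := exists_irrelevant_pow_le hx
    refine hN _ ⟨t, fun b hb => ?_⟩
    simpa using ht hb

/-- Every prime of the support contains `Ann N`, so the height bound makes `P` a prime of least
height in the support. -/
theorem ringKrullDim_quotient_eq_supportDim {P : Ideal (X.Cox k)}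
    (hP : P ∈ associatedPrimes (X.Cox k) N)
    (hle : P.height ≤ (Module.annihilator (X.Cox k) N).height) :
    ringKrullDim (X.Cox k ⧸ P) = Module.supportDim (X.Cox k) N := by
  have hPp : P.IsPrime := hP.isPrime
  obtain ⟨-, x, hx⟩ := mem_associatedPrimes_iff_exists.1 hP
  refine MvPolynomial.krullDim_eq_ringKrullDim_quotient (Module.support (X.Cox k) N)
    (fun p q hpq hp => Module.mem_support_mono hpq hp) ⟨P, hPp⟩ ?_ fun Q hQ =>
      hle.trans (Ideal.height_mono (Module.annihilator_le_of_mem_support hQ))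
  refine Module.mem_support_iff_exists_annihilator.2 ⟨x, fun a ha => (hx a).2 ?_⟩
  exact Submodule.mem_annihilator_span_singleton _ _ |>.1 ha

theorem unmixedIdeal_of_forall_height_le {I : Ideal (X.Cox k)}
    (h : ∀ P ∈ associatedPrimes (X.Cox k) (X.Cox k ⧸ I), P.height ≤ I.height) :
    UnmixedIdeal I := by
  intro P hP
  rw [← Module.supportDim_quotient_eq_ringKrullDim I]
  exact ringKrullDim_quotient_eq_supportDim hP (by rw [Ideal.annihilator_quotient]; exact h P hP)

theorem le_saturation (I : Ideal (X.Cox k)) : I ≤ X.saturation k I := fun s hs =>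
  mem_saturation_iff.2 fun _ _ => ⟨0, by simpa using hs⟩

theorem mem_associatedPrimes_of_mem_associatedPrimes_saturation [Module.Finite (X.Cox k) M]
    {P : Ideal (X.Cox k)} (hP : P ∈ associatedPrimes (X.Cox k)
      (X.Cox k ⧸ X.saturation k (Module.annihilator (X.Cox k) M))) :
    P ∈ associatedPrimes (X.Cox k) M ∧ ∃ σ ∈ X.cones, X.hat k σ ∉ P := by
  obtain ⟨hPp, x, hx⟩ := mem_associatedPrimes_iff_exists.1 hP
  obtain ⟨s, rfl⟩ := Submodule.Quotient.mk_surjective _ x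
  have hs : ∀ a, a ∈ P ↔ a * s ∈ X.saturation k (Module.annihilator (X.Cox k) M) := fun a => by
    rw [hx, ← Submodule.Quotient.mk_smul, Submodule.Quotient.mk_eq_zero, smul_eq_mul]
  obtain ⟨σ, hσ, hσP⟩ : ∃ σ ∈ X.cones, X.hat k σ ∉ P := by
    refine exists_hat_notMem fun h => hPp.ne_top ((Ideal.eq_top_iff_one _).2 ?_)
    rw [hs, one_mul, mem_saturation_iff]
    intro σ hσ
    obtain ⟨t, ht⟩ := mem_saturation_iff.1 ((hs _).1 (h (hat_mem_irrelevant hσ))) σ hσ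
    exact ⟨t + 1, by rwa [pow_succ, mul_assoc]⟩
  refine ⟨?_, σ, hσ, hσP⟩
  obtain ⟨T, hT⟩ := LinearMap.exists_pow_smul_eq_zero
    ((Module.annihilator (X.Cox k) M).mkQ ∘ₗ LinearMap.toSpanSingleton (X.Cox k) (X.Cox k) s ∘ₗ
      P.subtype) (X.hat k σ) (fun a => by
      obtain ⟨t, ht⟩ := mem_saturation_iff.1 ((hs a).1 a.2) σ hσ
      refine ⟨t, ?_⟩
      change X.hat k σ ^ t • Submodule.Quotient.mk (a.1 * s) = 0
      rw [← Submodule.Quotient.mk_smul]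
      exact (Submodule.Quotient.mk_eq_zero _).2 ht)
  -- `P` is the colon of the saturation by `s`, hence the exact annihilator of this finitely
  -- generated submodule once the uniform power is included; being minimal over that annihilator, it
  -- is associated to `L` and so to `M`.
  let L : Submodule (X.Cox k) M := LinearMap.range (LinearMap.lsmul (X.Cox k) M (X.hat k σ ^ T * s))
  have hL : Module.annihilator (X.Cox k) L = P := by
    have hL' : ∀ a, a ∈ Module.annihilator (X.Cox k) L ↔
        a * (X.hat k σ ^ T * s) ∈ Module.annihilator (X.Cox k) M := by
      intro a
      rw [Submodule.mem_annihilator, Module.mem_annihilator]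
      simp only [L, LinearMap.mem_range, forall_exists_index, forall_apply_eq_imp_iff,
        LinearMap.lsmul_apply, smul_smul]
    ext a
    rw [hL']
    constructor
    · intro ha
      have h1 := le_saturation _ ha
      rw [← mul_assoc, ← hs] at h1
      exact (hPp.mem_or_mem h1).resolve_right fun h => hσP (hPp.mem_of_pow_mem T h)
    · intro ha
      have h1 : X.hat k σ ^ T • (Submodule.Quotient.mk (a * s) :
        X.Cox k ⧸ Module.annihilator (X.Cox k) M) = 0 := hT ⟨a, ha⟩
      rw [← Submodule.Quotient.mk_smul] at h1
      have h2 : X.hat k σ ^ T * (a * s) ∈ Module.annihilator (X.Cox k) M :=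
        (Submodule.Quotient.mk_eq_zero _).1 h1
      rwa [mul_left_comm] at h2
  refine associatedPrimes.subset_of_injective L.injective_subtype
    (Module.associatedPrimes.minimalPrimes_annihilator_subset_associatedPrimes (X.Cox k) L ?_)
  rw [hL, Ideal.minimalPrimes_eq_subsingleton_self]
  exact Set.mem_singleton _

end SmoothProjectiveFan

/-! ### Unmixedness of virtually Cohen–Macaulay modules -/

theorem mainTheorem8 {n : ℕ} {ι : Type*} [Fintype ι] [DecidableEq ι]
    (X : SmoothProjectiveFan n ι) (k : Type*) [Field k] [IsAlgClosed k]
    (M : Type*) [AddCommGroup M] [Module (X.Cox k) M] [Module.Finite (X.Cox k) M]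
    (ℳ : X.Pic → AddSubgroup M) [DirectSum.Decomposition ℳ] [SetLike.GradedSMul (X.grading k) ℳ]
    (hM : X.IsVirtuallyCM k ℳ) :
    (X.IsSaturated k M → ∀ P ∈ associatedPrimes (X.Cox k) M,
      ringKrullDim (X.Cox k ⧸ P) = Module.supportDim (X.Cox k) M) ∧
    X.IsVirtuallyUnmixed k ℳ := by
  have hsat : SmoothProjectiveFan.UnmixedIdeal
      (X.saturation k (Module.annihilator (X.Cox k) M)) := by
    refine SmoothProjectiveFan.unmixedIdeal_of_forall_height_le fun P hP => ?_
    obtain ⟨hPM, σ, hσ, hσP⟩ :=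
      SmoothProjectiveFan.mem_associatedPrimes_of_mem_associatedPrimes_saturation hP
    rw [SmoothProjectiveFan.height_eq_of_mem_associatedPrimes hM.2 hPM hσ hσP]
    exact Ideal.height_mono (SmoothProjectiveFan.le_saturation _)
  refine ⟨fun hs P hP => ?_, fun P hP hrel => ?_, fun N _ _ 𝒩 _ _ hs hiso P hP => ?_, hsat,
    fun N _ _ 𝒩 _ _ hs hiso => ?_⟩
  · obtain ⟨σ, hσ, hσP⟩ := hs.exists_hat_notMem hP
    exact SmoothProjectiveFan.ringKrullDim_quotient_eq_supportDim hP
      (SmoothProjectiveFan.height_eq_of_mem_associatedPrimes hM.2 hP hσ hσP).le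
  · obtain ⟨σ, hσ, hσP⟩ := SmoothProjectiveFan.exists_hat_notMem (pow_one (X.irrelevant k) ▸
      hrel 1 le_rfl)
    exact SmoothProjectiveFan.ringKrullDim_quotient_eq_supportDim hP
      (SmoothProjectiveFan.height_eq_of_mem_associatedPrimes hM.2 hP hσ hσP).le
  · obtain ⟨σ, hσ, hσP⟩ := SmoothProjectiveFan.IsSaturated.exists_hat_notMem hs hP
    have hPM := SmoothProjectiveFan.mem_associatedPrimes_of_sheafIso hP hσ hσP hiso
    refine SmoothProjectiveFan.ringKrullDim_quotient_eq_supportDim hP ?_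
    rw [SmoothProjectiveFan.height_eq_of_mem_associatedPrimes hM.2 hPM hσ hσP,
      SmoothProjectiveFan.annihilator_eq_saturation hs hiso]
    exact Ideal.height_mono (SmoothProjectiveFan.le_saturation _)
  · rw [SmoothProjectiveFan.annihilator_eq_saturation hs hiso]
    exact hsat
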